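/- **Theorem 2.2.** Fix a complex number $q$ with $0<|q|<1$. For $x\in\mathbb C$ and $n\ge 0$ let $(x;q)_n=\prod_{i=0}^{n-1}(1-xq^i)$ and $(x;q)_\infty=\prod_{i\ge 0}(1-xq^i)$, and write $(x_1,\dots,x_m;q)_n=(x_1;q)_n\cdots(x_m;q)_n$ for $0\le n\le\infty$. Let $${}_8\phi_7\!\left[{a_0,a_1,\dots,a_7\atop b_1,\dots,b_7};q,z\right]=\sum_{k=0}^\infty\frac{(a_0,a_1,\dots,a_7;q)_k}{(q,b_1,\dots,b_7;q)_k}\,z^k .$$ For nonzero complex numbers $a,b,c,d,e,f,g$ put $$\rho(a,b;c,d,e,f,g)=\frac1b\sum_{k=0}^{\infty}\Big(1-\frac{aq^{2k+1}}{b}\Big)\frac{(-1/b;q)_{k+1}}{(-qa;q)_k}\,\frac{(-qa/c,-qa/d,-qa/e,-qa/f,-qa/g;q)_k}{(-c/b,-d/b,-e/b,-f/b,-g/b;q)_{k+1}}\Big(\frac{cdefg}{qa^2b^2}\Big)^k$$ and, with $\lambda=deg/abf$, $$\begin{aligned}R(a,b,c,d,e;f,g)={}&\frac1g\Big(\frac1b-\frac1a\Big)\frac{(q,c,f,qa/b,qb/a;q)_\infty}{(-qa,-qb,-c/a,-c/b,-d/a;q)_\infty}\\&\times\frac{(-qa/g,-qb/g,qd/f,qe/f,cf/ab,df/ab,ef/ab,deg/ab,cdeg/a^2b^2;q)_\infty}{(-d/b,-e/a,-e/b,-f/a,-f/b,f/g,qab/fg,q\lambda,cdefg/qa^2b^2;q)_\infty}\\&\times{}_8\phi_7\!\left[{\lambda,\,q\sqrt\lambda,\,-q\sqrt\lambda,\,de/ab,\,dg/ab,\,eg/ab,\,q/f,\,qab/cf\atop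 \sqrt\lambda,\,-\sqrt\lambda,\,qg/f,\,qe/f,\,qd/f,\,deg/ab,\,cdeg/a^2b^2};q,c\right].\end{aligned}$$ Suppose that $\max\{|cdefg/qa^2b^2|,|c|\}<1$ and that no denominator vanishes in $\rho(a,b;c,d,e,f,g)$, $\rho(b,a;c,d,e,f,g)$, $R(a,b,c,d,e;f,g)$ and $R(a,b,c,d,e;g,f)$ (that is, no factor $1-xq^n$ of a $q$-shifted factorial in a denominator is zero). Then the four series involved converge absolutely and $$\rho(a,b;c,d,e,f,g)-\rho(b,a;c,d,e,f,g)=R(a,b,c,d,e;f,g)+R(a,b,c,d,e;g,f).$$ -/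

import Mathlib

noncomputable section

/-- The finite `q`-shifted factorial `(x;q)_n = ∏_{i<n} (1 - x q^i)`, for `n ≥ 0`. -/
def qPoch (q x : ℂ) (n : ℕ) : ℂ := ∏ i ∈ Finset.range n, (1 - x * q ^ i)

/-- The infinite `q`-shifted factorial `(x;q)_∞ = ∏_{k≥0} (1 - x q^k)` (used for `|q| < 1`,
where the product converges absolutely). -/
def qPochInf (q x : ℂ) : ℂ := ∏' k : ℕ, (1 - x * q ^ k)

/-- The compact notation `(x₁, …, x_m; q)_n`. -/
def qPochs (q : ℂ) (xs : List ℂ) (n : ℕ) : ℂ := (xs.map fun x => qPoch q x n).prod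

/-- The compact notation `(x₁, …, x_m; q)_∞`. -/
def qPochsInf (q : ℂ) (xs : List ℂ) : ℂ := (xs.map fun x => qPochInf q x).prod

/-- The `k`-th term of the unilateral basic hypergeometric series with numerator parameters
`as = [a₀, …, a_r]`, denominator parameters `bs = [b₁, …, b_s]`, base `q` and argument `z`; the
exponent `bs.length + 1 - as.length` is `s - r`. -/
def phiTerm (q z : ℂ) (as bs : List ℂ) (k : ℕ) : ℂ :=
  qPochs q as k / (qPoch q q k * qPochs q bs k)
    * ((-1) ^ k * q ^ (k.choose 2)) ^ ((bs.length : ℤ) + 1 - (as.length : ℤ)) * z ^ k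

/-- The unilateral basic hypergeometric series `φ(as; bs; q, z)`. -/
def phi (q z : ℂ) (as bs : List ℂ) : ℂ := ∑' k : ℕ, phiTerm q z as bs k

/-- The principal complex square root. -/
def csqrt (z : ℂ) : ℂ := z ^ (1 / 2 : ℂ)

/-- The `k`-th term of the series in `ρ(a,b;c,d,e,f,g)` (without the prefactor `1/b`). -/
def rhoTerm (q a b c d e f g : ℂ) (k : ℕ) : ℂ :=
  (1 - a * q ^ (2 * k + 1) / b) * (qPoch q (-1 / b) (k + 1) / qPoch q (-(q * a)) k)
    * (qPochs q [-(q * a) / c, -(q * a) / d, -(q * a) / e, -(q * a) / f, -(q * a) / g] k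
        / qPochs q [-c / b, -d / b, -e / b, -f / b, -g / b] (k + 1))
    * (c * d * e * f * g / (q * a ^ 2 * b ^ 2)) ^ k

/-- The function `ρ(a,b;c,d,e,f,g)`. -/
def rho (q a b c d e f g : ℂ) : ℂ := 1 / b * ∑' k : ℕ, rhoTerm q a b c d e f g k

/-- Numerator parameters of the very-well-poised `₈φ₇` series in `R(a,b,c,d,e;f,g)`. -/
def RNum (q a b c d e f g : ℂ) : List ℂ :=
  [d * e * g / (a * b * f),
    q * csqrt (d * e * g / (a * b * f)), -(q * csqrt (d * e * g / (a * b * f))),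
    d * e / (a * b), d * g / (a * b), e * g / (a * b), q / f, q * a * b / (c * f)]

/-- Denominator parameters (apart from `q`) of the very-well-poised `₈φ₇` series in
`R(a,b,c,d,e;f,g)`. -/
def RDen (q a b c d e f g : ℂ) : List ℂ :=
  [csqrt (d * e * g / (a * b * f)), -csqrt (d * e * g / (a * b * f)),
    q * g / f, q * e / f, q * d / f, d * e * g / (a * b), c * d * e * g / (a ^ 2 * b ^ 2)]

/-- The function `R(a,b,c,d,e;f,g)`. -/
def R (q a b c d e f g : ℂ) : ℂ :=
  1 / g * (1 / b - 1 / a)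
    * (qPochsInf q [q, c, f, q * a / b, q * b / a]
        / qPochsInf q [-(q * a), -(q * b), -c / a, -c / b, -d / a])
    * (qPochsInf q [-(q * a) / g, -(q * b) / g, q * d / f, q * e / f, c * f / (a * b),
          d * f / (a * b), e * f / (a * b), d * e * g / (a * b),
          c * d * e * g / (a ^ 2 * b ^ 2)]
        / qPochsInf q [-d / b, -e / a, -e / b, -f / a, -f / b, f / g, q * a * b / (f * g),
          q * d * e * g / (a * b * f), c * d * e * f * g / (q * a ^ 2 * b ^ 2)])
    * phi q c (RNum q a b c d e f g) (RDen q a b c d e f g)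

end

/-!
# A three-term relation between bilateral and unilateral very-well-poised series

Put `p = ab`. After multiplication by the infinite products in their denominators, the two series
`ρ(a,b; …)` and `ρ(b,a; …)` become the two halves of one very-well-poised `₈ψ₈` series, summed over
`X = aq^n` with `n ∈ ℤ` (`psi8Sum`; see `rhoTerm_mul_rhoFactor`). Its `n`-th term contains, for each
of six parameters `c`, the product `pairInf q p c X = (-c/X, -cqX/p; q)_∞`; the six parameters are
`c₁ = ab`, `c₂ = c`, `d`, `e`, `f`, `g`. It is convenient to let `c₁` and `c₂` be free: the claim
then becomes `BilateralIdentity`, an identity between functions that are holomorphic in `c₁`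
and in `c₂` as long as the series converge.

The proof of `bilateralIdentity` combines three summation formulas and analytic continuation.

* Bailey's nonterminating extension of Jackson's `₈φ₇` sum (`dougSum_eq`) writes
  `pairInf d · pairInf e` as a combination of two infinite series, in whose `m`-th terms `X` occurs
  only in products that merge with `pairInf f · pairInf g`. It follows from a contiguous relation
  in `d`, established by telescoping, and its symmetry in `d` and `e`, which reduce it to the limit
  `d, e → 0`; this limit is the nonterminating `q`-Chu–Vandermonde sum (`vanSum_eq`), again
  obtained from a contiguous relation.
* When this expansion is inserted into the `₈ψ₈` series, the inner series are `₆ψ₆` series with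
  parameters `c₁, c₂, fq^{-m}, (deg/p)q^m` (`dougTerm_mul_eq_psi6Term`). If `c₂ = -p/a` and
  `c₁ = -aq^{N+1}` with `N ≥ 0`, they are finite sums and are evaluated by `psi6Sum_eq`. The outer
  sum is then the `₈φ₇` series of `R` (`sum_psi8Term_eq`).
* Both sides of the identity are multiplied by the same factor when `a` is replaced by `qa`
  (`psi8Sum_mul_base`, `vwpTheta_mul_base`, `thetaPair_step`). This extends the identity to
  `c₂ = -(p/a)q^M` with `M ≥ 0` and `c₁ = -aq^{N+1-M}`. For fixed `M` these values of `c₁`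
  accumulate at `0`, as do the values of `c₂`, and the identity theorem, applied first in `c₁` and
  then in `c₂`, gives the general case.

All series involved have terms whose ratio is a continuous function of the parameters and of `q^n`,
which is recorded by `RatioAt`; this single notion yields summability, continuity and holomorphy.
-/

open Filter Topology

/-! ### Infinite and finite `q`-shifted factorials -/

section QPoch

variable {q : ℂ}

theorem qPoch_zero (q x : ℂ) : qPoch q x 0 = 1 := by simp [qPoch]

theorem qPoch_one (q x : ℂ) : qPoch q x 1 = 1 - x := by simp [qPoch]

theorem qPoch_succ (q x : ℂ) (n : ℕ) : qPoch q x (n + 1) = qPoch q x n * (1 - x * q ^ n) := by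
  simp [qPoch, Finset.prod_range_succ]

theorem qPoch_succ' (q x : ℂ) (n : ℕ) : qPoch q x (n + 1) = (1 - x) * qPoch q (x * q) n := by
  simp only [qPoch, Finset.prod_range_succ', pow_zero, mul_one]
  rw [mul_comm]
  congr 1
  exact Finset.prod_congr rfl fun i _ => by ring

theorem qPoch_zero_left (q : ℂ) (n : ℕ) : qPoch q 0 n = 1 := by simp [qPoch]

theorem qPoch_ne_zero {x : ℂ} (h : ∀ n : ℕ, x * q ^ n ≠ 1) (n : ℕ) : qPoch q x n ≠ 0 :=
  Finset.prod_ne_zero_iff.2 fun i _ => sub_ne_zero.2 (h i).symm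

theorem differentiable_qPoch (q : ℂ) (n : ℕ) : Differentiable ℂ fun x => qPoch q x n := by
  unfold qPoch
  fun_prop

theorem summable_norm_mul_pow (hq : ‖q‖ < 1) (x : ℂ) : Summable fun k : ℕ => ‖-(x * q ^ k)‖ := by
  simpa using (summable_geometric_of_lt_one (norm_nonneg q) hq).mul_left ‖x‖

theorem multipliable_qPochInf (hq : ‖q‖ < 1) (x : ℂ) :
    Multipliable fun k : ℕ => 1 - x * q ^ k := by
  simpa [sub_eq_add_neg] using multipliable_one_add_of_summable (summable_norm_mul_pow hq x)

theorem qPochInf_zero_left (q : ℂ) : qPochInf q 0 = 1 := by simp [qPochInf]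

theorem qPochInf_ne_zero (hq : ‖q‖ < 1) {x : ℂ} (h : ∀ n : ℕ, x * q ^ n ≠ 1) :
    qPochInf q x ≠ 0 := by
  have := tprod_one_add_ne_zero_of_summable (f := fun k : ℕ => -(x * q ^ k))
    (fun i => by simpa [← sub_eq_add_neg, sub_eq_zero] using (h i).symm)
    (summable_norm_mul_pow hq x)
  simpa [qPochInf, sub_eq_add_neg] using this

theorem qPochInf_eq_qPoch_mul (hq : ‖q‖ < 1) (x : ℂ) (n : ℕ) :
    qPochInf q x = qPoch q x n * qPochInf q (x * q ^ n) := by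
  induction n with
  | zero => simp [qPoch_zero]
  | succ n ih =>
    rw [ih, qPoch_succ, mul_assoc]
    congr 1
    rw [qPochInf, tprod_eq_zero_mul' (f := fun k : ℕ => 1 - x * q ^ n * q ^ k)]
    · simp only [pow_zero, mul_one, qPochInf]
      congr 1
      exact tprod_congr fun k => by ring
    · refine (multipliable_qPochInf hq (x * q ^ (n + 1))).congr fun k => by ring

theorem qPochInf_step (hq : ‖q‖ < 1) (x : ℂ) : qPochInf q x = (1 - x) * qPochInf q (x * q) := by
  simpa [qPoch] using qPochInf_eq_qPoch_mul hq x 1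

/-- The functional equation `(x;q)_∞ = (1 - x) (qx;q)_∞`, in a form that lets `rw` name both
arguments. -/
theorem qPochInf_step_of_eq (hq : ‖q‖ < 1) {x y : ℂ} (h : y = x * q) :
    qPochInf q x = (1 - x) * qPochInf q y := h ▸ qPochInf_step hq x

theorem qPochInf_eq_zero (hq : ‖q‖ < 1) {x : ℂ} {n : ℕ} (h : x * q ^ n = 1) :
    qPochInf q x = 0 := by
  rw [qPochInf_eq_qPoch_mul hq x (n + 1), qPoch_succ, h]
  simp

theorem qPochInf_ne_zero_of_norm_lt (hq : ‖q‖ < 1) {x : ℂ} (hx : ‖x‖ < 1) :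
    qPochInf q x ≠ 0 := by
  refine qPochInf_ne_zero hq fun n h => ?_
  have h1 : ‖x * q ^ n‖ < 1 := by
    rw [norm_mul, norm_pow]
    calc ‖x‖ * ‖q‖ ^ n ≤ ‖x‖ * 1 := by gcongr; exact pow_le_one₀ (norm_nonneg q) hq.le
      _ < 1 := by simpa using hx
  simp [h] at h1

theorem differentiable_qPochInf (hq : ‖q‖ < 1) : Differentiable ℂ (qPochInf q) := by
  intro x
  have hx : x ∈ Metric.ball (0 : ℂ) (‖x‖ + 1) := by simp
  have key : HasProdLocallyUniformlyOn (fun (k : ℕ) (x : ℂ) => 1 + -(x * q ^ k))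
      (fun x => ∏' k : ℕ, (1 + -(x * q ^ k))) (Metric.ball (0 : ℂ) (‖x‖ + 1)) := by
    refine Summable.hasProdLocallyUniformlyOn_nat_one_add Metric.isOpen_ball
      ((summable_geometric_of_lt_one (norm_nonneg q) hq).mul_left (‖x‖ + 1))
      (Eventually.of_forall fun n y hy => ?_) (fun n => by fun_prop)
    rw [norm_neg, norm_mul, norm_pow]
    gcongr
    exact (mem_ball_zero_iff.1 hy).le
  have h2 : DifferentiableOn ℂ (fun x => ∏' k : ℕ, (1 + -(x * q ^ k)))
      (Metric.ball (0 : ℂ) (‖x‖ + 1)) :=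
    key.differentiableOn (.of_forall fun _ => by
      simpa [Finset.prod_fn] using DifferentiableOn.finsetProd (fun _ _ => by fun_prop))
      Metric.isOpen_ball
  have h3 := h2.differentiableAt (Metric.isOpen_ball.mem_nhds hx)
  exact h3.congr_of_eventuallyEq (.of_forall fun y => by simp [qPochInf, sub_eq_add_neg])

theorem continuous_qPochInf (hq : ‖q‖ < 1) : Continuous (qPochInf q) :=
  (differentiable_qPochInf hq).continuous

theorem tendsto_const_mul_pow_zero (hq : ‖q‖ < 1) (x : ℂ) :
    Tendsto (fun n : ℕ => x * q ^ n) atTop (𝓝 0) := by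
  simpa using (tendsto_pow_atTop_nhds_zero_of_norm_lt_one hq).const_mul x

theorem tendsto_qPochInf_mul_pow (hq : ‖q‖ < 1) (x : ℂ) :
    Tendsto (fun n : ℕ => qPochInf q (x * q ^ n)) atTop (𝓝 1) := by
  have := (continuous_qPochInf hq).continuousAt.tendsto.comp (tendsto_const_mul_pow_zero hq x)
  simpa [Function.comp_def, qPochInf_zero_left] using this

theorem tendsto_qPoch (hq : ‖q‖ < 1) (x : ℂ) :
    Tendsto (fun n : ℕ => qPoch q x n) atTop (𝓝 (qPochInf q x)) :=
  (multipliable_qPochInf hq x).hasProd.tendsto_prod_nat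

/-- The product `∏_{1 ≤ i ≤ n} (q^i - x)`. Multiplied by `(x;q)_∞` it is the polynomially
normalised form of `(x q^{-n};q)_∞`; unlike the latter it makes sense for `x → 0`. -/
def qDesc (q x : ℂ) (n : ℕ) : ℂ := ∏ i ∈ Finset.range n, (q ^ (i + 1) - x)

theorem qDesc_zero (q x : ℂ) : qDesc q x 0 = 1 := by simp [qDesc]

theorem qDesc_succ (q x : ℂ) (n : ℕ) : qDesc q x (n + 1) = qDesc q x n * (q ^ (n + 1) - x) := by
  simp [qDesc, Finset.prod_range_succ]

theorem differentiable_qDesc (q : ℂ) (n : ℕ) : Differentiable ℂ fun x => qDesc q x n := by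
  unfold qDesc
  fun_prop

/-- Reversing the factors: `∏_{1 ≤ i ≤ n} (q^i - x) = (-x)^n (q/x;q)_n`. -/
theorem qDesc_eq_qPoch {x : ℂ} (hx : x ≠ 0) (n : ℕ) :
    qDesc q x n = (-x) ^ n * qPoch q (q / x) n := by
  induction n with
  | zero => simp [qDesc_zero, qPoch_zero]
  | succ n ih =>
    rw [qDesc_succ, qPoch_succ, ih]
    field_simp
    ring

theorem qPochInf_div_pow (hq0 : q ≠ 0) (hq : ‖q‖ < 1) (x : ℂ) (n : ℕ) :
    q ^ ((n + 1).choose 2) * qPochInf q (x / q ^ n) = qDesc q x n * qPochInf q x := by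
  induction n with
  | zero => simp [qDesc_zero]
  | succ n ih =>
    have h : qPochInf q (x / q ^ (n + 1)) = (1 - x / q ^ (n + 1)) * qPochInf q (x / q ^ n) :=
      qPochInf_step_of_eq hq (by field_simp; ring)
    rw [qDesc_succ, mul_right_comm, ← ih, h, Nat.choose_succ_succ' (n + 1) 1, pow_add]
    simp only [Nat.choose_one_right]
    field_simp

end QPoch

/-! ### Series with a geometric ratio -/

section RatioAt

variable {X : Type*} [TopologicalSpace X] {q : ℂ} {u v : ℕ → X → ℂ} {t₀ : X} {l m : ℂ}

/-- Near the parameter `t₀` and for large `n`, the ratio `u (n+1) t / u n t` is `Q t (q^n)` for a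
function `Q` that is continuous at `(t₀, 0)`, with value `l` there. For `q`-hypergeometric terms
this is the usual shape of the ratio, and `l` is the argument of the series. -/
def RatioAt (q : ℂ) (u : ℕ → X → ℂ) (t₀ : X) (l : ℂ) : Prop :=
  ∃ Q : X × ℂ → ℂ, ContinuousAt Q (t₀, 0) ∧ Q (t₀, 0) = l ∧
    ∀ᶠ z in 𝓝 t₀ ×ˢ atTop, u (z.2 + 1) z.1 = Q (z.1, q ^ z.2) * u z.2 z.1

theorem tendsto_prodMk_pow (hq : ‖q‖ < 1) (t₀ : X) :
    Tendsto (fun z : X × ℕ => (z.1, q ^ z.2)) (𝓝 t₀ ×ˢ atTop) (𝓝 (t₀, 0)) := by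
  rw [nhds_prod_eq]
  exact tendsto_fst.prodMk ((tendsto_pow_atTop_nhds_zero_of_norm_lt_one hq).comp tendsto_snd)

theorem RatioAt.mul (hu : RatioAt q u t₀ l) (hv : RatioAt q v t₀ m) :
    RatioAt q (fun n t => u n t * v n t) t₀ (l * m) := by
  obtain ⟨Q, hQ, hl, hr⟩ := hu
  obtain ⟨Q', hQ', hl', hr'⟩ := hv
  refine ⟨fun z => Q z * Q' z, hQ.mul hQ', by simp only [hl, hl'], ?_⟩
  filter_upwards [hr, hr'] with z h h'
  rw [h, h']
  ring

theorem RatioAt.inv (hu : RatioAt q u t₀ l) (hl0 : l ≠ 0) :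
    RatioAt q (fun n t => (u n t)⁻¹) t₀ l⁻¹ := by
  obtain ⟨Q, hQ, hl, hr⟩ := hu
  refine ⟨fun z => (Q z)⁻¹, hQ.inv₀ (hl ▸ hl0), by simp only [hl], ?_⟩
  filter_upwards [hr] with z h
  rw [h, mul_inv]

theorem RatioAt.div (hu : RatioAt q u t₀ l) (hv : RatioAt q v t₀ m) (hm : m ≠ 0) :
    RatioAt q (fun n t => u n t / v n t) t₀ (l / m) := by
  simpa only [div_eq_mul_inv] using hu.mul (hv.inv hm)

theorem RatioAt.of_const (w : X → ℂ) : RatioAt q (fun _ t => w t) t₀ 1 :=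
  ⟨fun _ => 1, continuousAt_const, rfl, .of_forall fun z => by simp⟩

theorem RatioAt.of_pow {w : X → ℂ} (hw : ContinuousAt w t₀) :
    RatioAt q (fun n t => w t ^ n) t₀ (w t₀) :=
  ⟨fun z => w z.1, hw.comp (f := Prod.fst) (x := (t₀, (0 : ℂ))) continuousAt_fst, rfl,
    .of_forall fun z => by simp only [pow_succ, mul_comm]⟩

theorem RatioAt.of_one_sub {w : X → ℂ} (hq : ‖q‖ < 1) (hw : ContinuousAt w t₀) :
    RatioAt q (fun n t => 1 - w t * q ^ (2 * n)) t₀ 1 := by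
  have hw' : ContinuousAt (fun z : X × ℂ => w z.1) (t₀, 0) :=
    hw.comp (f := Prod.fst) (x := (t₀, (0 : ℂ))) continuousAt_fst
  have hc : ContinuousAt (fun z : X × ℂ => 1 - w z.1 * z.2 ^ 2) (t₀, 0) := by fun_prop
  refine ⟨fun z => (1 - w z.1 * (q * z.2) ^ 2) / (1 - w z.1 * z.2 ^ 2), ?_, by simp, ?_⟩
  · exact ContinuousAt.div (by fun_prop) hc (by simp)
  · have h0 := (hc.tendsto.comp (tendsto_prodMk_pow hq t₀)).eventually_ne
      (b₂ := 0) (by simp)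
    filter_upwards [h0] with z hz
    simp only [Function.comp_apply] at hz
    rw [← pow_mul, mul_comm z.2 2] at hz ⊢
    rw [div_mul_cancel₀ _ hz]
    ring

theorem RatioAt.of_qPoch {w : X → ℂ} (hw : ContinuousAt w t₀) :
    RatioAt q (fun n t => qPoch q (w t) n) t₀ 1 := by
  have hw' : ContinuousAt (fun z : X × ℂ => w z.1) (t₀, 0) :=
    hw.comp (f := Prod.fst) (x := (t₀, (0 : ℂ))) continuousAt_fst
  exact ⟨fun z => 1 - w z.1 * z.2, by fun_prop, by simp,
    .of_forall fun z => by simp only [qPoch_succ, mul_comm]⟩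

theorem RatioAt.of_qDesc {w : X → ℂ} (hw : ContinuousAt w t₀) :
    RatioAt q (fun n t => qDesc q (w t) n) t₀ (-w t₀) := by
  have hw' : ContinuousAt (fun z : X × ℂ => w z.1) (t₀, 0) :=
    hw.comp (f := Prod.fst) (x := (t₀, (0 : ℂ))) continuousAt_fst
  exact ⟨fun z => q * z.2 - w z.1, by fun_prop, by simp,
    .of_forall fun z => by simp only [qDesc_succ]; ring⟩

theorem RatioAt.of_qPochInf {w : X → ℂ} (hq : ‖q‖ < 1) (hw : ContinuousAt w t₀) :
    RatioAt q (fun n t => qPochInf q (w t * q ^ n)) t₀ 1 := by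
  have hw' : ContinuousAt (fun z : X × ℂ => w z.1) (t₀, 0) :=
    hw.comp (f := Prod.fst) (x := (t₀, (0 : ℂ))) continuousAt_fst
  have hc : ContinuousAt (fun z : X × ℂ => 1 - w z.1 * z.2) (t₀, 0) := by fun_prop
  refine ⟨fun z => (1 - w z.1 * z.2)⁻¹, hc.inv₀ (by simp), by simp, ?_⟩
  have h0 := (hc.tendsto.comp (tendsto_prodMk_pow hq t₀)).eventually_ne (b₂ := 0) (by simp)
  filter_upwards [h0] with z hz
  simp only [Function.comp_apply] at hz
  rw [qPochInf_step_of_eq hq (x := w z.1 * q ^ z.2) (y := w z.1 * q ^ (z.2 + 1)) (by ring),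
    inv_mul_cancel_left₀ hz]

theorem RatioAt.comp {Y : Type*} [TopologicalSpace Y] {φ : Y → X} {y₀ : Y}
    (hφ : ContinuousAt φ y₀) (hu : RatioAt q u (φ y₀) l) :
    RatioAt q (fun n y => u n (φ y)) y₀ l := by
  obtain ⟨Q, hQ, hl, hr⟩ := hu
  have hφ' : ContinuousAt (fun z : Y × ℂ => (φ z.1, z.2)) (y₀, 0) :=
    (hφ.comp (f := Prod.fst) (x := (y₀, (0 : ℂ))) continuousAt_fst).prodMk continuousAt_snd
  refine ⟨fun z => Q (φ z.1, z.2), ContinuousAt.comp (f := fun z : Y × ℂ => (φ z.1, z.2))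
    (x := (y₀, (0 : ℂ))) hQ hφ', hl, ?_⟩
  exact (hφ.tendsto.prodMap tendsto_id).eventually hr

/-- A limiting ratio of modulus less than one gives a summable bound, uniform near `t₀`. -/
theorem RatioAt.exists_bound (hq : ‖q‖ < 1) (hu : RatioAt q u t₀ l) (hl1 : ‖l‖ < 1)
    (hc : ∀ n, ContinuousAt (u n) t₀) :
    ∃ b : ℕ → ℝ, Summable b ∧ ∀ᶠ t in 𝓝 t₀, ∀ n, ‖u n t‖ ≤ b n := by
  obtain ⟨Q, hQ, hl, hr⟩ := hu
  obtain ⟨r, hr0, hr1⟩ := exists_between hl1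
  have hr0' : 0 ≤ r := (norm_nonneg l).trans hr0.le
  have hQr := (hQ.norm.tendsto.comp (tendsto_prodMk_pow hq t₀)).eventually_lt_const
    (u := r) (by rw [hl]; exact hr0)
  obtain ⟨S, hS, h⟩ := (hr.and hQr).exists_mem
  obtain ⟨s, hs, s', hs', hab⟩ := mem_prod_iff.1 hS
  obtain ⟨N, hN⟩ := mem_atTop_sets.1 hs'
  have hnear : ∀ᶠ t in 𝓝 t₀, ∀ n ∈ Finset.range (N + 1), ‖u n t‖ ≤ ‖u n t₀‖ + 1 := by
    rw [eventually_all_finset]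
    intro n _
    exact ((hc n).norm.eventually_le_const (by linarith))
  refine ⟨fun n => if n ≤ N then ‖u n t₀‖ + 1 else (‖u N t₀‖ + 1) * r ^ (n - N), ?_, ?_⟩
  · rw [← summable_nat_add_iff (N + 1)]
    refine ((summable_geometric_of_lt_one hr0' hr1).mul_left ((‖u N t₀‖ + 1) * r)).congr
      fun n => ?_
    rw [if_neg (by omega), show n + (N + 1) - N = n + 1 by omega]
    ring
  · filter_upwards [hnear, hs] with t ht hts
    have hstep : ∀ k, ‖u (N + k) t‖ ≤ (‖u N t₀‖ + 1) * r ^ k := by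
      intro k
      induction k with
      | zero => simpa using ht N (by simp)
      | succ k ih =>
        obtain ⟨h1, h2⟩ := h (t, N + k) (hab ⟨hts, hN _ (by omega)⟩)
        simp only [Function.comp_apply] at h1 h2
        rw [← add_assoc, h1, norm_mul, pow_succ]
        calc ‖Q (t, q ^ (N + k))‖ * ‖u (N + k) t‖ ≤ r * ((‖u N t₀‖ + 1) * r ^ k) := by gcongr
          _ = _ := by ring
    intro n
    split_ifs with hn
    · exact ht n (Finset.mem_range.2 (by omega))
    · have := hstep (n - N)
      rwa [show N + (n - N) = n by omega] at this

theorem RatioAt.summable (hq : ‖q‖ < 1) (hu : RatioAt q u t₀ l) (hl1 : ‖l‖ < 1) :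
    Summable fun n => u n t₀ := by
  have hu' : RatioAt q (fun n (_ : Unit) => u n t₀) () l :=
    hu.comp (φ := fun _ : Unit => t₀) continuousAt_const
  obtain ⟨b, hb, h⟩ := hu'.exists_bound hq hl1 fun n => continuousAt_const
  exact hb.of_norm_bounded fun n => h.self_of_nhds n

theorem RatioAt.continuousAt_tsum (hq : ‖q‖ < 1) (hu : RatioAt q u t₀ l) (hl1 : ‖l‖ < 1)
    (hc : ∀ n, ContinuousAt (u n) t₀) : ContinuousAt (fun t => ∑' n, u n t) t₀ := by
  obtain ⟨b, hb, h⟩ := hu.exists_bound hq hl1 hc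
  exact tendsto_tsum_of_dominated_convergence hb (fun n => hc n) h

theorem RatioAt.differentiableOn_tsum (hq : ‖q‖ < 1) {u : ℕ → ℂ → ℂ} {s : Set ℂ} (hs : IsOpen s)
    {l : ℂ → ℂ} (hu : ∀ t ∈ s, RatioAt q u t (l t)) (hl1 : ∀ t ∈ s, ‖l t‖ < 1)
    (hd : ∀ n, DifferentiableOn ℂ (u n) s) : DifferentiableOn ℂ (fun t => ∑' n, u n t) s := by
  intro t ht
  obtain ⟨b, hb, h⟩ := (hu t ht).exists_bound hq (hl1 t ht)
    fun n => ((hd n).differentiableAt (hs.mem_nhds ht)).continuousAt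
  obtain ⟨s', hs', hso, hts⟩ := eventually_nhds_iff.1 (h.and (hs.mem_nhds ht))
  refine (DifferentiableOn.differentiableAt (s := s') ?_
    (hso.mem_nhds hts)).differentiableWithinAt
  exact Complex.differentiableOn_tsum_of_summable_norm hb
    (fun n => (hd n).mono fun x hx => (hs' x hx).2) hso fun n w hw => (hs' w hw).1 n

end RatioAt

/-! ### The nonterminating `q`-Chu–Vandermonde sum -/

theorem tsum_eq_of_telescoping {D G : ℕ → ℂ} {L : ℂ} (hs : Summable D) (h0 : D 0 = G 0)
    (hstep : ∀ n, D (n + 1) = G (n + 1) - G n) (hG : Tendsto G atTop (𝓝 L)) :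
    ∑' n, D n = L := by
  have hsum : ∀ n, ∑ i ∈ Finset.range (n + 1), D i = G n := by
    intro n
    induction n with
    | zero => simpa using h0
    | succ n ih => rw [Finset.sum_range_succ, ih, hstep]; ring
  have h1 := (tendsto_add_atTop_iff_nat 1).2 hs.hasSum.tendsto_sum_nat
  simp only [hsum] at h1
  exact tendsto_nhds_unique h1 hG

section Vandermonde

variable {q f g : ℂ}

theorem q_mul_pow_ne_one (hq : ‖q‖ < 1) (n : ℕ) : q * q ^ n ≠ 1 := by
  intro h
  have h1 : ‖q ^ (n + 1)‖ < 1 := by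
    rw [norm_pow]
    exact pow_lt_one₀ (norm_nonneg q) hq (by omega)
  rw [pow_succ', h] at h1
  simp at h1

theorem mul_q_mul_pow_ne_one {x : ℂ} (h : ∀ n : ℕ, x * q ^ n ≠ 1) (n : ℕ) :
    q * x * q ^ n ≠ 1 := by
  have := h (n + 1)
  rwa [pow_succ', ← mul_assoc, mul_comm x] at this

/-- The boundary terms of the two telescoping sums related by `f ↔ g` cancel because of this
antisymmetry of the theta function. -/
theorem inv_theta_antisymm (hq : ‖q‖ < 1) (hf : f ≠ 0) (hg : g ≠ 0)
    (hfg : ∀ n : ℕ, f / g * q ^ n ≠ 1) (hgf : ∀ n : ℕ, g / f * q ^ n ≠ 1) :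
    f / (qPochInf q (f / g) * qPochInf q (q * g / f))
      + g / (qPochInf q (g / f) * qPochInf q (q * f / g)) = 0 := by
  have h1 : qPochInf q (f / g) = (1 - f / g) * qPochInf q (q * f / g) :=
    qPochInf_step_of_eq hq (by ring)
  have h2 : qPochInf q (g / f) = (1 - g / f) * qPochInf q (q * g / f) :=
    qPochInf_step_of_eq hq (by ring)
  have n1 : qPochInf q (f / g) ≠ 0 := qPochInf_ne_zero hq hfg
  have n2 : qPochInf q (g / f) ≠ 0 := qPochInf_ne_zero hq hgf
  rw [h1] at n1
  rw [h2] at n2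
  obtain ⟨n3, n4⟩ := mul_ne_zero_iff.1 n1
  obtain ⟨n5, n6⟩ := mul_ne_zero_iff.1 n2
  have n7 : g - f ≠ 0 := fun h => n3 (by rw [sub_eq_zero.1 h, div_self hf, sub_self])
  have n8 : f - g ≠ 0 := fun h => n7 (by rw [← neg_sub, h, neg_zero])
  rw [h1, h2]
  field_simp
  ring

/-- One of the two series in the nonterminating `q`-Chu–Vandermonde sum, normalised so that the
sum becomes symmetric under `f ↔ g`. -/
noncomputable def vanTerm (q f g α β : ℂ) (n : ℕ) : ℂ :=
  q ^ n * qPoch q (α / f) n * qPoch q (β / f) n * qPochInf q (α / g) * qPochInf q (β / g)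
    / (qPoch q q n * qPochInf q (f / g) * qPoch q (q * g / f) n)

/-- The telescoping certificate for the contiguity `α → αq` of `vanTerm`. -/
noncomputable def vanCert (q f g α β : ℂ) (n : ℕ) : ℂ :=
  -(α / (f * g)) * (qPoch q (α * q / f) n * qPoch q (β / f) (n + 1) * qPochInf q (α * q / g)
    * qPochInf q (β / g)) * (f / (qPochInf q (f / g) * qPoch q (q * g / f) n)) / qPoch q q n

theorem vanTerm_contiguous_zero (hq : ‖q‖ < 1) (hf : f ≠ 0) (hg : g ≠ 0)
    (hfg : ∀ n : ℕ, f / g * q ^ n ≠ 1) (α β : ℂ) :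
    vanTerm q f g α β 0 - (1 - α * β / (f * g)) * vanTerm q f g (α * q) β 0
      = vanCert q f g α β 0 := by
  have n1 : qPochInf q (f / g) ≠ 0 := qPochInf_ne_zero hq hfg
  have h1 : qPochInf q (α / g) = (1 - α / g) * qPochInf q (α * q / g) :=
    qPochInf_step_of_eq hq (by ring)
  simp only [vanTerm, vanCert, qPoch_zero, qPoch_succ, h1]
  field_simp
  ring

theorem vanTerm_contiguous_succ (hq : ‖q‖ < 1) (hf : f ≠ 0) (hg : g ≠ 0)
    (hfg : ∀ n : ℕ, f / g * q ^ n ≠ 1) (hgf : ∀ n : ℕ, g / f * q ^ n ≠ 1) (α β : ℂ) (n : ℕ) :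
    vanTerm q f g α β (n + 1) - (1 - α * β / (f * g)) * vanTerm q f g (α * q) β (n + 1)
      = vanCert q f g α β (n + 1) - vanCert q f g α β n := by
  have n1 : qPochInf q (f / g) ≠ 0 := qPochInf_ne_zero hq hfg
  have hqgf : ∀ n : ℕ, q * g / f * q ^ n ≠ 1 := by
    simpa only [mul_div_assoc] using mul_q_mul_pow_ne_one hgf
  have n2 : qPoch q (q * g / f) n ≠ 0 := qPoch_ne_zero hqgf n
  have n3 : 1 - q * g / f * q ^ n ≠ 0 := sub_ne_zero.2 (hqgf n).symm
  have n4 : qPoch q q n ≠ 0 := qPoch_ne_zero (q_mul_pow_ne_one hq) n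
  have n5 : 1 - q * q ^ n ≠ 0 := sub_ne_zero.2 (q_mul_pow_ne_one hq n).symm
  have h1 : qPochInf q (α / g) = (1 - α / g) * qPochInf q (α * q / g) :=
    qPochInf_step_of_eq hq (by ring)
  have h2 : qPoch q (α / f) (n + 1) = (1 - α / f) * qPoch q (α * q / f) n := by
    rw [qPoch_succ', div_mul_eq_mul_div]
  simp only [vanTerm, vanCert, h1, h2, qPoch_succ _ _ n, qPoch_succ _ _ (n + 1)]
  generalize qPoch q (α * q / f) n = A1 at *
  generalize qPoch q (β / f) n = A2 at *
  generalize qPochInf q (α * q / g) = A3 at *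
  generalize qPochInf q (β / g) = A4 at *
  generalize qPoch q (q * g / f) n = A5 at *
  generalize qPoch q q n = A6 at *
  generalize qPochInf q (f / g) = A7 at *
  rw [pow_succ]
  generalize q ^ n = y at *
  have n3' : f - y * q * g ≠ 0 := fun h => n3 (by field_simp; linear_combination h)
  have n5' : 1 - y * q ≠ 0 := by rwa [mul_comm]
  field_simp
  ring

theorem ratioAt_vanTerm (f g β t : ℂ) :
    RatioAt q (fun n α => vanTerm q f g α β n) t q := by
  have := (((((RatioAt.of_pow (q := q) (w := fun _ : ℂ => q) (t₀ := t) continuousAt_const).mul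
    (RatioAt.of_qPoch (w := fun α : ℂ => α / f) (by fun_prop))).mul
    (RatioAt.of_qPoch (w := fun _ : ℂ => β / f) (by fun_prop))).mul
    (RatioAt.of_const fun α : ℂ => qPochInf q (α / g))).mul
    (RatioAt.of_const fun _ : ℂ => qPochInf q (β / g))).div
    (((RatioAt.of_qPoch (w := fun _ : ℂ => q) (by fun_prop)).mul
    (RatioAt.of_const fun _ : ℂ => qPochInf q (f / g))).mul
    (RatioAt.of_qPoch (w := fun _ : ℂ => q * g / f) (by fun_prop))) (by simp)
  simpa [vanTerm] using this

theorem summable_vanTerm (hq : ‖q‖ < 1) (f g α β : ℂ) : Summable (vanTerm q f g α β) :=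
  (ratioAt_vanTerm f g β α).summable hq hq

theorem continuous_tsum_vanTerm (hq : ‖q‖ < 1) (f g β : ℂ) :
    Continuous fun α => ∑' n, vanTerm q f g α β n := by
  refine continuous_iff_continuousAt.2 fun t =>
    (ratioAt_vanTerm f g β t).continuousAt_tsum hq hq fun n => ?_
  have h1 := (differentiable_qPoch q n).continuous
  have h2 := continuous_qPochInf hq
  unfold vanTerm
  refine Continuous.continuousAt ?_
  refine Continuous.div_const ?_ _
  have h3 : Continuous fun α => qPoch q (α / f) n := h1.comp (continuous_id.div_const f)
  have h4 : Continuous fun α => qPochInf q (α / g) := h2.comp (continuous_id.div_const g)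
  fun_prop

theorem tendsto_vanCert (hq : ‖q‖ < 1) (hfg : ∀ n : ℕ, f / g * q ^ n ≠ 1)
    (hgf : ∀ n : ℕ, g / f * q ^ n ≠ 1) (α β : ℂ) :
    Tendsto (vanCert q f g α β) atTop
      (𝓝 (-(α / (f * g)) * (qPochInf q (α * q / f) * qPochInf q (β / f) * qPochInf q (α * q / g)
        * qPochInf q (β / g)) * (f / (qPochInf q (f / g) * qPochInf q (q * g / f)))
        / qPochInf q q)) := by
  have n1 : qPochInf q (f / g) ≠ 0 := qPochInf_ne_zero hq hfg
  have n2 : qPochInf q (q * g / f) ≠ 0 :=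
    qPochInf_ne_zero hq (by simpa only [mul_div_assoc] using mul_q_mul_pow_ne_one hgf)
  have n3 : qPochInf q q ≠ 0 := qPochInf_ne_zero hq (q_mul_pow_ne_one hq)
  unfold vanCert
  refine Tendsto.div (Tendsto.mul (Tendsto.const_mul _ ?_) (Tendsto.div tendsto_const_nhds
    ((tendsto_qPoch hq _).const_mul _) (mul_ne_zero n1 n2))) (tendsto_qPoch hq q) n3
  exact (((tendsto_qPoch hq _).mul ((tendsto_add_atTop_iff_nat 1).2 (tendsto_qPoch hq _))).mul
    tendsto_const_nhds).mul tendsto_const_nhds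

/-- The left side of the nonterminating `q`-Chu–Vandermonde sum. -/
noncomputable def vanSum (q f g α β : ℂ) : ℂ :=
  ∑' n, vanTerm q f g α β n + ∑' n, vanTerm q g f α β n

theorem vanSum_contiguous (hq : ‖q‖ < 1) (hf : f ≠ 0) (hg : g ≠ 0)
    (hfg : ∀ n : ℕ, f / g * q ^ n ≠ 1) (hgf : ∀ n : ℕ, g / f * q ^ n ≠ 1) (α β : ℂ) :
    vanSum q f g α β = (1 - α * β / (f * g)) * vanSum q f g (α * q) β := by
  have hs := fun f g α => summable_vanTerm hq f g α β
  have h1 := tsum_eq_of_telescoping ((hs f g α).sub ((hs f g (α * q)).mul_left _))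
    (vanTerm_contiguous_zero hq hf hg hfg α β) (vanTerm_contiguous_succ hq hf hg hfg hgf α β)
    (tendsto_vanCert hq hfg hgf α β)
  have h2 := tsum_eq_of_telescoping ((hs g f α).sub ((hs g f (α * q)).mul_left _))
    (vanTerm_contiguous_zero hq hg hf hgf α β) (vanTerm_contiguous_succ hq hg hf hgf hfg α β)
    (tendsto_vanCert hq hgf hfg α β)
  rw [(hs _ _ _).tsum_sub ((hs _ _ _).mul_left _), tsum_mul_left] at h1 h2
  have h3 := inv_theta_antisymm hq hf hg hfg hgf
  rw [mul_comm g f] at h2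
  unfold vanSum
  linear_combination h1 + h2 - α / (f * g) * (qPochInf q (α * q / f) * qPochInf q (β / f)
    * qPochInf q (α * q / g) * qPochInf q (β / g)) / qPochInf q q * h3

theorem vanSum_comm (q f g α β : ℂ) : vanSum q f g α β = vanSum q f g β α := by
  have h : ∀ f g n, vanTerm q f g α β n = vanTerm q f g β α n := fun f g n => by
    unfold vanTerm; ring
  simp only [vanSum, h]

theorem vanSum_eq_mul_vanSum_zero (hq : ‖q‖ < 1) (hf : f ≠ 0) (hg : g ≠ 0)
    (hfg : ∀ n : ℕ, f / g * q ^ n ≠ 1) (hgf : ∀ n : ℕ, g / f * q ^ n ≠ 1) (α β : ℂ) :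
    vanSum q f g α β = qPochInf q (α * β / (f * g)) * vanSum q f g 0 β := by
  have h1 : ∀ N : ℕ, vanSum q f g α β
      = qPoch q (α * β / (f * g)) N * vanSum q f g (α * q ^ N) β := by
    intro N
    induction N with
    | zero => simp [qPoch_zero]
    | succ N ih =>
      rw [ih, vanSum_contiguous hq hf hg hfg hgf, qPoch_succ, pow_succ, ← mul_assoc α]
      ring
  have hc : Continuous fun α => vanSum q f g α β :=
    (continuous_tsum_vanTerm hq f g β).add (continuous_tsum_vanTerm hq g f β)
  have h2 : Tendsto (fun N : ℕ => vanSum q f g (α * q ^ N) β) atTop (𝓝 (vanSum q f g 0 β)) :=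
    (hc.tendsto 0).comp (tendsto_const_mul_pow_zero hq α)
  exact tendsto_nhds_unique (tendsto_const_nhds.congr h1) ((tendsto_qPoch hq _).mul h2)

/-- The nonterminating `q`-Chu–Vandermonde sum. The contiguity `α → αq` reduces it to `α = β = 0`,
and that constant is read off at `α = f`, where one series stops at its first term and the other
one vanishes. -/
theorem vanSum_eq (hq : ‖q‖ < 1) (hf : f ≠ 0) (hg : g ≠ 0)
    (hfg : ∀ n : ℕ, f / g * q ^ n ≠ 1) (hgf : ∀ n : ℕ, g / f * q ^ n ≠ 1) (α β : ℂ) :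
    vanSum q f g α β = qPochInf q (α * β / (f * g)) := by
  have key := vanSum_eq_mul_vanSum_zero hq hf hg hfg hgf
  have n1 : qPochInf q (f / g) ≠ 0 := qPochInf_ne_zero hq hfg
  have h0 : vanSum q f g 0 0 = 1 := by
    have h := key f 0
    simp only [mul_zero, zero_div, qPochInf_zero_left, one_mul] at h
    rw [← h, vanSum, tsum_eq_single 0]
    · have h2 : ∀ n, vanTerm q g f f 0 n = 0 := fun n => by
        have : qPochInf q (f / f) = 0 := qPochInf_eq_zero hq (n := 0) (by simp [hf])
        simp [vanTerm, this]
      rw [tsum_congr h2, tsum_zero]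
      simp [vanTerm, qPoch_zero, qPochInf_zero_left, n1]
    · intro n hn
      obtain ⟨m, rfl⟩ := Nat.exists_eq_succ_of_ne_zero hn
      have : qPoch q (f / f) (m + 1) = 0 := by rw [qPoch_succ', div_self hf]; simp
      simp [vanTerm, this]
  rw [key, vanSum_comm, key, h0]
  simp [qPochInf_zero_left]

end Vandermonde

/-! ### The nonterminating `₈φ₇` sum -/

section Dougall

variable {q d e f g x z : ℂ}

/-- One of the two very-well-poised series in Bailey's nonterminating `₈φ₇` sum (the
nonterminating form of Jackson's `q`-Dougall sum), with base parameter `λ = degxz/f`. The infinite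
products are distributed so that the sum of the two series is symmetric under `f ↔ g` and has a
limit as `d → 0` or `e → 0`. -/
noncomputable def dougTerm (q d e f g x z : ℂ) (n : ℕ) : ℂ :=
  q ^ n * (1 - d * e * g * x * z / f * q ^ (2 * n)) * qPoch q (d * e * x * z) n
    * qPoch q (d * g * x * z) n * qPoch q (e * g * x * z) n * qPoch q (-q / (x * f)) n
    * qPoch q (-1 / (z * f)) n * qPochInf q (q * e / f * q ^ n) * qPochInf q (q * d / f * q ^ n)
    * qPochInf q (-(d * e * g * x ^ 2 * z) * q ^ n)
    * qPochInf q (-(q * d * e * g * x * z ^ 2) * q ^ n)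
    * (qPochInf q (d * f * x * z) * qPochInf q (e * f * x * z) * qPochInf q (-q / (x * g))
      * qPochInf q (-1 / (z * g)))
    / (qPochInf q (d * e * g * x * z / f * q ^ n) * qPoch q q n
      * (qPochInf q (f / g) * qPoch q (q * g / f) n))

/-- The telescoping certificate for the contiguity `d → dq` of `dougTerm`. -/
noncomputable def dougCert (q d e f g x z : ℂ) (n : ℕ) : ℂ :=
  -(d * x * z) * (1 - d ^ 2 * e * g * x ^ 2 * z ^ 2 * q * q ^ n)
    * (qPoch q (d * q * e * x * z) n * qPoch q (d * q * g * x * z) n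
    * qPoch q (e * g * x * z) (n + 1) * qPoch q (-q / (x * f)) (n + 1)
    * qPoch q (-1 / (z * f)) (n + 1) * qPochInf q (q * e / f * q ^ n)
    * qPochInf q (q * (d * q) / f * q ^ n)
    * qPochInf q (-(d * q * e * g * x ^ 2 * z) * q ^ n)
    * qPochInf q (-(q * (d * q) * e * g * x * z ^ 2) * q ^ n)
    * (qPochInf q (d * q * f * x * z) * qPochInf q (e * f * x * z) * qPochInf q (-q / (x * g))
      * qPochInf q (-1 / (z * g))))
    / (qPochInf q (d * q * e * g * x * z / f * q ^ n) * qPoch q q n)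
    * (f / (qPochInf q (f / g) * qPoch q (q * g / f) n))

/-- The rational identity behind the contiguity `d → dq`, with `y = q^n`. -/
theorem doug_certificate_identity (hf : f ≠ 0) (hx : x ≠ 0) (hz : z ≠ 0) (q d e g y : ℂ) :
    y * (1 - d * e * g * x * z / f * y ^ 2) * ((1 - d * e * x * z) * (1 - d * g * x * z)
        * (1 - d * f * x * z)) * ((1 - q * d / f * y) * (1 + d * e * g * x ^ 2 * z * y)
        * (1 + q * d * e * g * x * z ^ 2 * y))
      - (1 + d * x) * (1 + q * d * z) * (1 - d * e * f * g * x ^ 2 * z ^ 2)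
        * (y * (1 - d * q * e * g * x * z / f * y ^ 2) * ((1 - d * e * g * x * z / f * y)
        * (1 - d * e * x * z * y) * (1 - d * g * x * z * y)))
    = -(d * x * z) * f * (1 - d ^ 2 * e * g * x ^ 2 * z ^ 2 * q * y)
        * ((1 - d * e * g * x * z / f * y) * (1 - d * e * x * z * y) * (1 - d * g * x * z * y))
        * ((1 - e * g * x * z * y) * (1 - -q / (x * f) * y) * (1 - -1 / (z * f) * y))
      - -(d * x * z) * f * (1 - d ^ 2 * e * g * x ^ 2 * z ^ 2 * y)
        * ((1 - q * d / f * y) * (1 + d * e * g * x ^ 2 * z * y)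
        * (1 + q * d * e * g * x * z ^ 2 * y))
        * ((1 - e / f * y) * (1 - y) * (1 - g / f * y)) := by
  field_simp
  ring

/-- The case `y = 1` of `doug_certificate_identity` after cancelling two common factors, which may
vanish. -/
theorem doug_certificate_identity_one (hf : f ≠ 0) (hx : x ≠ 0) (hz : z ≠ 0) (q d e g : ℂ) :
    (1 - d * f * x * z) * ((1 - q * d / f) * (1 + d * e * g * x ^ 2 * z)
        * (1 + q * d * e * g * x * z ^ 2))
      - (1 + d * x) * (1 + q * d * z) * (1 - d * e * f * g * x ^ 2 * z ^ 2)
        * (1 - d * q * e * g * x * z / f)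
    = -(d * x * z) * f * (1 - d ^ 2 * e * g * x ^ 2 * z ^ 2 * q)
        * ((1 - e * g * x * z) * (1 - -q / (x * f)) * (1 - -1 / (z * f))) := by
  field_simp
  ring

theorem dougTerm_eq_mul_inv (q d e f g x z : ℂ) (n : ℕ) : dougTerm q d e f g x z n
    = q ^ n * (1 - d * e * g * x * z / f * q ^ (2 * n)) * qPoch q (d * e * x * z) n
    * qPoch q (d * g * x * z) n * qPoch q (e * g * x * z) n * qPoch q (-q / (x * f)) n
    * qPoch q (-1 / (z * f)) n * qPochInf q (q * e / f * q ^ n) * qPochInf q (q * d / f * q ^ n)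
    * qPochInf q (-(d * e * g * x ^ 2 * z) * q ^ n)
    * qPochInf q (-(q * d * e * g * x * z ^ 2) * q ^ n)
    * (qPochInf q (d * f * x * z) * qPochInf q (e * f * x * z) * qPochInf q (-q / (x * g))
      * qPochInf q (-1 / (z * g)))
    * (qPochInf q (d * e * g * x * z / f * q ^ n))⁻¹ * (qPoch q q n)⁻¹
    * (qPochInf q (f / g))⁻¹ * (qPoch q (q * g / f) n)⁻¹ := by
  unfold dougTerm
  ring

theorem dougCert_eq_mul_inv (q d e f g x z : ℂ) (n : ℕ) : dougCert q d e f g x z n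
    = -(d * x * z) * f * (1 - d ^ 2 * e * g * x ^ 2 * z ^ 2 * q * q ^ n)
    * (qPoch q (d * q * e * x * z) n * qPoch q (d * q * g * x * z) n
    * qPoch q (e * g * x * z) (n + 1) * qPoch q (-q / (x * f)) (n + 1)
    * qPoch q (-1 / (z * f)) (n + 1) * qPochInf q (q * e / f * q ^ n)
    * qPochInf q (q * (d * q) / f * q ^ n)
    * qPochInf q (-(d * q * e * g * x ^ 2 * z) * q ^ n)
    * qPochInf q (-(q * (d * q) * e * g * x * z ^ 2) * q ^ n)
    * (qPochInf q (d * q * f * x * z) * qPochInf q (e * f * x * z) * qPochInf q (-q / (x * g))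
      * qPochInf q (-1 / (z * g))))
    * (qPochInf q (d * q * e * g * x * z / f * q ^ n))⁻¹ * (qPoch q q n)⁻¹
    * (qPochInf q (f / g))⁻¹ * (qPoch q (q * g / f) n)⁻¹ := by
  unfold dougCert
  ring

theorem dougTerm_contiguous_zero (hq : ‖q‖ < 1) (hf : f ≠ 0) (hx : x ≠ 0) (hz : z ≠ 0)
    (hl : ∀ n : ℕ, d * e * g * x * z / f * q ^ n ≠ 1) :
    dougTerm q d e f g x z 0 - (1 + d * x) * (1 + q * d * z)
        * (1 - d * e * f * g * x ^ 2 * z ^ 2) * dougTerm q (d * q) e f g x z 0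
      = dougCert q d e f g x z 0 := by
  have n1 : 1 - d * e * g * x * z / f ≠ 0 :=
    sub_ne_zero.2 (by simpa using (hl 0).symm)
  have h1 : (qPochInf q (d * q * e * g * x * z / f))⁻¹
      = (1 - d * e * g * x * z / f) * (qPochInf q (d * e * g * x * z / f))⁻¹ := by
    rw [qPochInf_step_of_eq hq (x := d * e * g * x * z / f) (y := d * q * e * g * x * z / f)
      (by ring), mul_inv, mul_inv_cancel_left₀ n1]
  have h2 : qPochInf q (q * d / f) = (1 - q * d / f) * qPochInf q (q * (d * q) / f) :=
    qPochInf_step_of_eq hq (by ring)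
  have h3 : qPochInf q (-(d * e * g * x ^ 2 * z))
      = (1 + d * e * g * x ^ 2 * z) * qPochInf q (-(d * q * e * g * x ^ 2 * z)) := by
    rw [← sub_neg_eq_add]; exact qPochInf_step_of_eq hq (by ring)
  have h4 : qPochInf q (-(q * d * e * g * x * z ^ 2))
      = (1 + q * d * e * g * x * z ^ 2) * qPochInf q (-(q * (d * q) * e * g * x * z ^ 2)) := by
    rw [← sub_neg_eq_add]; exact qPochInf_step_of_eq hq (by ring)
  have h5 : qPochInf q (d * f * x * z)
      = (1 - d * f * x * z) * qPochInf q (d * q * f * x * z) :=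
    qPochInf_step_of_eq hq (by ring)
  have key := doug_certificate_identity_one hf hx hz q d e g
  rw [dougTerm_eq_mul_inv, dougTerm_eq_mul_inv, dougCert_eq_mul_inv]
  simp only [qPoch_one, qPoch_zero, pow_zero, mul_zero, mul_one, zero_add, inv_one]
  rw [h1, h2, h3, h4, h5]
  linear_combination (qPochInf q (q * e / f) * qPochInf q (q * (d * q) / f)
    * qPochInf q (-(d * q * e * g * x ^ 2 * z)) * qPochInf q (-(q * (d * q) * e * g * x * z ^ 2))
    * (qPochInf q (d * q * f * x * z) * qPochInf q (e * f * x * z) * qPochInf q (-q / (x * g))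
      * qPochInf q (-1 / (z * g))) * (qPochInf q (d * e * g * x * z / f))⁻¹
    * (qPochInf q (f / g))⁻¹ * (1 - d * e * g * x * z / f)) * key

theorem dougTerm_contiguous_succ (hq : ‖q‖ < 1) (hf : f ≠ 0) (hx : x ≠ 0) (hz : z ≠ 0)
    (hgf : ∀ n : ℕ, g / f * q ^ n ≠ 1)
    (hl : ∀ n : ℕ, d * e * g * x * z / f * q ^ n ≠ 1) (n : ℕ) :
    dougTerm q d e f g x z (n + 1) - (1 + d * x) * (1 + q * d * z)
        * (1 - d * e * f * g * x ^ 2 * z ^ 2) * dougTerm q (d * q) e f g x z (n + 1)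
      = dougCert q d e f g x z (n + 1) - dougCert q d e f g x z n := by
  obtain ⟨y, hy⟩ : ∃ y, y = q ^ (n + 1) := ⟨_, rfl⟩
  have hy' : q ^ n * q = y := by rw [hy, pow_succ]
  have n1 : 1 - d * e * g * x * z / f * y ≠ 0 := hy ▸ sub_ne_zero.2 (hl (n + 1)).symm
  have n2 : 1 - y ≠ 0 := sub_ne_zero.2 fun h => q_mul_pow_ne_one hq n (by rw [h, ← hy', mul_comm])
  have n3 : 1 - g / f * y ≠ 0 := hy ▸ sub_ne_zero.2 (hgf (n + 1)).symm
  have h1 : (qPochInf q (d * q * e * g * x * z / f * y))⁻¹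
      = (1 - d * e * g * x * z / f * y) * (qPochInf q (d * e * g * x * z / f * y))⁻¹ := by
    rw [qPochInf_step_of_eq hq (x := d * e * g * x * z / f * y)
      (y := d * q * e * g * x * z / f * y) (by ring), mul_inv, mul_inv_cancel_left₀ n1]
  have h1' : d * q * e * g * x * z / f * q ^ n = d * e * g * x * z / f * y := by
    rw [← hy']; ring
  have h2 : qPochInf q (q * d / f * y) = (1 - q * d / f * y) * qPochInf q (q * (d * q) / f * y) :=
    qPochInf_step_of_eq hq (by ring)
  have h2' : q * (d * q) / f * q ^ n = q * d / f * y := by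
    rw [← hy']; ring
  have h3 : qPochInf q (-(d * e * g * x ^ 2 * z) * y)
      = (1 + d * e * g * x ^ 2 * z * y) * qPochInf q (-(d * q * e * g * x ^ 2 * z) * y) := by
    rw [qPochInf_step_of_eq hq (y := -(d * q * e * g * x ^ 2 * z) * y)
      (by ring), neg_mul, sub_neg_eq_add]
  have h3' : -(d * q * e * g * x ^ 2 * z) * q ^ n = -(d * e * g * x ^ 2 * z) * y := by
    rw [← hy']; ring
  have h4 : qPochInf q (-(q * d * e * g * x * z ^ 2) * y)
      = (1 + q * d * e * g * x * z ^ 2 * y)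
        * qPochInf q (-(q * (d * q) * e * g * x * z ^ 2) * y) := by
    rw [qPochInf_step_of_eq hq (y := -(q * (d * q) * e * g * x * z ^ 2) * y)
      (by ring), neg_mul, sub_neg_eq_add]
  have h4' : -(q * (d * q) * e * g * x * z ^ 2) * q ^ n = -(q * d * e * g * x * z ^ 2) * y := by
    rw [← hy']; ring
  have h5 : qPochInf q (d * f * x * z)
      = (1 - d * f * x * z) * qPochInf q (d * q * f * x * z) :=
    qPochInf_step_of_eq hq (by ring)
  have h6 : qPochInf q (q * e / f * q ^ n) = (1 - e / f * y) * qPochInf q (q * e / f * y) := by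
    rw [show e / f * y = q * e / f * q ^ n by rw [← hy']; ring]
    exact qPochInf_step_of_eq hq (by rw [← hy']; ring)
  have h7 : (qPoch q q n)⁻¹ = (1 - y) * (qPoch q q (n + 1))⁻¹ := by
    rw [qPoch_succ, mul_comm q, hy', mul_inv, mul_comm, inv_mul_cancel_right₀ n2]
  have h8 : (qPoch q (q * g / f) n)⁻¹ = (1 - g / f * y) * (qPoch q (q * g / f) (n + 1))⁻¹ := by
    rw [qPoch_succ, show q * g / f * q ^ n = g / f * y by rw [← hy']; ring, mul_inv,
      mul_comm _ (1 - g / f * y)⁻¹, mul_inv_cancel_left₀ n3]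
  have h9 : qPoch q (d * e * x * z) (n + 1)
      = (1 - d * e * x * z) * qPoch q (d * q * e * x * z) n := by
    rw [qPoch_succ', show d * e * x * z * q = d * q * e * x * z by ring]
  have h9' : qPoch q (d * q * e * x * z) (n + 1)
      = qPoch q (d * q * e * x * z) n * (1 - d * e * x * z * y) := by
    rw [qPoch_succ, ← hy']; ring
  have h10 : qPoch q (d * g * x * z) (n + 1)
      = (1 - d * g * x * z) * qPoch q (d * q * g * x * z) n := by
    rw [qPoch_succ', show d * g * x * z * q = d * q * g * x * z by ring]
  have h10' : qPoch q (d * q * g * x * z) (n + 1)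
      = qPoch q (d * q * g * x * z) n * (1 - d * g * x * z * y) := by
    rw [qPoch_succ, ← hy']; ring
  have key := doug_certificate_identity hf hx hz q d e g y
  rw [dougTerm_eq_mul_inv, dougTerm_eq_mul_inv, dougCert_eq_mul_inv, dougCert_eq_mul_inv]
  rw [qPoch_succ _ _ (n + 1), qPoch_succ _ _ (n + 1), qPoch_succ _ _ (n + 1), mul_comm 2 (n + 1),
    pow_mul, ← hy, h1', h2', h3', h4', mul_assoc _ q (q ^ n), mul_comm q (q ^ n), hy']
  rw [h1, h2, h3, h4, h5, h6, h7, h8, h9, h9', h10, h10']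
  linear_combination (qPoch q (d * q * e * x * z) n * qPoch q (d * q * g * x * z) n
    * qPoch q (e * g * x * z) (n + 1) * qPoch q (-q / (x * f)) (n + 1)
    * qPoch q (-1 / (z * f)) (n + 1) * qPochInf q (q * e / f * y)
    * qPochInf q (q * (d * q) / f * y)
    * qPochInf q (-(d * q * e * g * x ^ 2 * z) * y)
    * qPochInf q (-(q * (d * q) * e * g * x * z ^ 2) * y)
    * (qPochInf q (d * q * f * x * z) * qPochInf q (e * f * x * z) * qPochInf q (-q / (x * g))
      * qPochInf q (-1 / (z * g))) * (qPochInf q (d * e * g * x * z / f * y))⁻¹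
    * (qPoch q q (n + 1))⁻¹ * (qPochInf q (f / g))⁻¹ * (qPoch q (q * g / f) (n + 1))⁻¹) * key

theorem ratioAt_dougTerm (hq : ‖q‖ < 1) (e f g x z t : ℂ) :
    RatioAt q (fun n d => dougTerm q d e f g x z n) t q := by
  have := ((((((((((((RatioAt.of_pow (q := q) (w := fun _ : ℂ => q) (t₀ := t)
      continuousAt_const).mul
    (RatioAt.of_one_sub (w := fun d : ℂ => d * e * g * x * z / f) hq (by fun_prop))).mul
    (RatioAt.of_qPoch (w := fun d : ℂ => d * e * x * z) (by fun_prop))).mul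
    (RatioAt.of_qPoch (w := fun d : ℂ => d * g * x * z) (by fun_prop))).mul
    (RatioAt.of_qPoch (w := fun _ : ℂ => e * g * x * z) (by fun_prop))).mul
    (RatioAt.of_qPoch (w := fun _ : ℂ => -q / (x * f)) (by fun_prop))).mul
    (RatioAt.of_qPoch (w := fun _ : ℂ => -1 / (z * f)) (by fun_prop))).mul
    (RatioAt.of_qPochInf (w := fun _ : ℂ => q * e / f) hq (by fun_prop))).mul
    (RatioAt.of_qPochInf (w := fun d : ℂ => q * d / f) hq (by fun_prop))).mul
    (RatioAt.of_qPochInf (w := fun d : ℂ => -(d * e * g * x ^ 2 * z)) hq (by fun_prop))).mul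
    (RatioAt.of_qPochInf (w := fun d : ℂ => -(q * d * e * g * x * z ^ 2)) hq (by fun_prop))).mul
    (RatioAt.of_const fun d : ℂ => qPochInf q (d * f * x * z) * qPochInf q (e * f * x * z)
      * qPochInf q (-q / (x * g)) * qPochInf q (-1 / (z * g)))).div
    (((RatioAt.of_qPochInf (w := fun d : ℂ => d * e * g * x * z / f) hq (by fun_prop)).mul
    (RatioAt.of_qPoch (w := fun _ : ℂ => q) (by fun_prop))).mul
    ((RatioAt.of_const fun _ : ℂ => qPochInf q (f / g)).mul
    (RatioAt.of_qPoch (w := fun _ : ℂ => q * g / f) (by fun_prop)))) (by simp)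
  simpa [dougTerm] using this

theorem summable_dougTerm (hq : ‖q‖ < 1) (d e f g x z : ℂ) :
    Summable (dougTerm q d e f g x z) :=
  (ratioAt_dougTerm hq e f g x z d).summable hq hq

theorem continuousAt_tsum_dougTerm (hq : ‖q‖ < 1) (e f g x z : ℂ) :
    ContinuousAt (fun d => ∑' n, dougTerm q d e f g x z n) 0 := by
  refine (ratioAt_dougTerm hq e f g x z 0).continuousAt_tsum hq hq fun n => ?_
  have h1 : Continuous fun x => qPoch q x n := (differentiable_qPoch q n).continuous
  have h2 := continuous_qPochInf hq
  have c1 : Continuous fun d => qPoch q (d * e * x * z) n := h1.comp (by fun_prop)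
  have c2 : Continuous fun d => qPoch q (d * g * x * z) n := h1.comp (by fun_prop)
  have c3 : ContinuousAt (fun d => qPochInf q (d * e * g * x * z / f * q ^ n) * qPoch q q n
      * (qPochInf q (f / g) * qPoch q (q * g / f) n)) 0 := by fun_prop
  unfold dougTerm
  by_cases h0 : qPoch q q n * (qPochInf q (f / g) * qPoch q (q * g / f) n) = 0
  · have h0' : ∀ A : ℂ, A * qPoch q q n * (qPochInf q (f / g) * qPoch q (q * g / f) n) = 0 :=
      fun A => by rw [mul_assoc, h0, mul_zero]
    simp only [h0', div_zero]
    exact continuousAt_const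
  · refine ContinuousAt.div (by fun_prop) c3 ?_
    rw [mul_assoc]
    refine mul_ne_zero ?_ h0
    simp [qPochInf_zero_left]

theorem tendsto_dougCert (hq : ‖q‖ < 1) (hfg : ∀ n : ℕ, f / g * q ^ n ≠ 1)
    (hgf : ∀ n : ℕ, g / f * q ^ n ≠ 1) (d e x z : ℂ) :
    Tendsto (dougCert q d e f g x z) atTop
      (𝓝 (-(d * x * z)
        * (qPochInf q (d * q * e * x * z) * qPochInf q (d * q * g * x * z)
        * qPochInf q (e * g * x * z) * qPochInf q (-q / (x * f)) * qPochInf q (-1 / (z * f))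
        * (qPochInf q (d * q * f * x * z) * qPochInf q (e * f * x * z)
          * qPochInf q (-q / (x * g)) * qPochInf q (-1 / (z * g))))
        / qPochInf q q * (f / (qPochInf q (f / g) * qPochInf q (q * g / f))))) := by
  have n1 : qPochInf q (f / g) ≠ 0 := qPochInf_ne_zero hq hfg
  have n2 : qPochInf q (q * g / f) ≠ 0 :=
    qPochInf_ne_zero hq (by simpa only [mul_div_assoc] using mul_q_mul_pow_ne_one hgf)
  have n3 : qPochInf q q ≠ 0 := qPochInf_ne_zero hq (q_mul_pow_ne_one hq)
  have t1 : Tendsto (fun n : ℕ => 1 - d ^ 2 * e * g * x ^ 2 * z ^ 2 * q * q ^ n) atTop (𝓝 1) := by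
    simpa using (tendsto_const_mul_pow_zero hq (d ^ 2 * e * g * x ^ 2 * z ^ 2 * q)).const_sub 1
  have t2 := fun x : ℂ => tendsto_qPoch hq x
  have t3 := fun x : ℂ => (tendsto_add_atTop_iff_nat 1).2 (tendsto_qPoch hq x)
  have t4 := fun x : ℂ => tendsto_qPochInf_mul_pow hq x
  have := ((((t1.const_mul (-(d * x * z))).mul ((((((((((t2 (d * q * e * x * z)).mul
    (t2 (d * q * g * x * z))).mul (t3 (e * g * x * z))).mul (t3 (-q / (x * f)))).mul
    (t3 (-1 / (z * f)))).mul (t4 (q * e / f))).mul (t4 (q * (d * q) / f))).mul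
    (t4 (-(d * q * e * g * x ^ 2 * z)))).mul (t4 (-(q * (d * q) * e * g * x * z ^ 2)))).mul
    (tendsto_const_nhds (x := qPochInf q (d * q * f * x * z) * qPochInf q (e * f * x * z)
      * qPochInf q (-q / (x * g)) * qPochInf q (-1 / (z * g)))))).div
    ((t4 (d * q * e * g * x * z / f)).mul (t2 q)) (by simpa using n3))).mul
    (Tendsto.div (tendsto_const_nhds (x := f)) ((t2 (q * g / f)).const_mul (qPochInf q (f / g)))
      (mul_ne_zero n1 n2))
  unfold dougCert
  simpa only [mul_one, one_mul, Pi.div_apply] using this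

/-- The left side of the nonterminating `₈φ₇` sum. -/
noncomputable def dougSum (q d e f g x z : ℂ) : ℂ :=
  ∑' n, dougTerm q d e f g x z n + ∑' n, dougTerm q d e g f x z n

theorem dougSum_contiguous (hq : ‖q‖ < 1) (hf : f ≠ 0) (hg : g ≠ 0) (hx : x ≠ 0) (hz : z ≠ 0)
    (hfg : ∀ n : ℕ, f / g * q ^ n ≠ 1) (hgf : ∀ n : ℕ, g / f * q ^ n ≠ 1)
    (hl : ∀ n : ℕ, d * e * g * x * z / f * q ^ n ≠ 1)
    (hl' : ∀ n : ℕ, d * e * f * x * z / g * q ^ n ≠ 1) :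
    dougSum q d e f g x z = (1 + d * x) * (1 + q * d * z)
      * (1 - d * e * f * g * x ^ 2 * z ^ 2) * dougSum q (d * q) e f g x z := by
  have hs := fun f g d => summable_dougTerm hq d e f g x z
  have h1 := tsum_eq_of_telescoping ((hs f g d).sub ((hs f g (d * q)).mul_left _))
    (dougTerm_contiguous_zero hq hf hx hz hl) (dougTerm_contiguous_succ hq hf hx hz hgf hl)
    (tendsto_dougCert hq hfg hgf d e x z)
  have h2 := tsum_eq_of_telescoping ((hs g f d).sub ((hs g f (d * q)).mul_left _))
    (dougTerm_contiguous_zero hq hg hx hz hl') (dougTerm_contiguous_succ hq hg hx hz hfg hl')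
    (tendsto_dougCert hq hgf hfg d e x z)
  rw [(hs _ _ _).tsum_sub ((hs _ _ _).mul_left _), tsum_mul_left] at h1 h2
  have h3 := inv_theta_antisymm hq hf hg hfg hgf
  unfold dougSum
  linear_combination h1 + h2 - d * x * z
        * (qPochInf q (d * q * e * x * z) * qPochInf q (d * q * g * x * z)
        * qPochInf q (e * g * x * z) * qPochInf q (-q / (x * f)) * qPochInf q (-1 / (z * f))
        * (qPochInf q (d * q * f * x * z) * qPochInf q (e * f * x * z)
          * qPochInf q (-q / (x * g)) * qPochInf q (-1 / (z * g))))
        / qPochInf q q * h3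

theorem dougSum_comm (q d e f g x z : ℂ) : dougSum q d e f g x z = dougSum q e d f g x z := by
  have h : ∀ f g n, dougTerm q d e f g x z n = dougTerm q e d f g x z n := fun f g n => by
    unfold dougTerm
    simp only [mul_comm d e, mul_right_comm q d e]
    ring
  simp only [dougSum, h]

theorem dougSum_eq_mul_dougSum_zero (hq : ‖q‖ < 1) (hf : f ≠ 0) (hg : g ≠ 0) (hx : x ≠ 0)
    (hz : z ≠ 0) (hfg : ∀ n : ℕ, f / g * q ^ n ≠ 1) (hgf : ∀ n : ℕ, g / f * q ^ n ≠ 1)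
    (hl : ∀ n : ℕ, d * e * g * x * z / f * q ^ n ≠ 1)
    (hl' : ∀ n : ℕ, d * e * f * x * z / g * q ^ n ≠ 1) :
    dougSum q d e f g x z = qPochInf q (-d * x) * qPochInf q (-q * d * z)
      * qPochInf q (d * e * f * g * x ^ 2 * z ^ 2) * dougSum q 0 e f g x z := by
  have h1 : ∀ N : ℕ, dougSum q d e f g x z
      = qPoch q (-d * x) N * qPoch q (-q * d * z) N * qPoch q (d * e * f * g * x ^ 2 * z ^ 2) N
        * dougSum q (d * q ^ N) e f g x z := by
    intro N
    induction N with
    | zero => simp [qPoch_zero]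
    | succ N ih =>
      rw [ih, dougSum_contiguous hq hf hg hx hz hfg hgf, qPoch_succ, qPoch_succ, qPoch_succ,
        show d * q ^ (N + 1) = d * q ^ N * q by ring]
      · ring
      · intro n h
        exact hl (N + n) (by rw [← h]; ring)
      · intro n h
        exact hl' (N + n) (by rw [← h]; ring)
  have hc : ContinuousAt (fun d => dougSum q d e f g x z) 0 :=
    (continuousAt_tsum_dougTerm hq e f g x z).add (continuousAt_tsum_dougTerm hq e g f x z)
  have h2 : Tendsto (fun N : ℕ => dougSum q (d * q ^ N) e f g x z) atTop
      (𝓝 (dougSum q 0 e f g x z)) :=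
    hc.tendsto.comp (tendsto_const_mul_pow_zero hq d)
  exact tendsto_nhds_unique (tendsto_const_nhds.congr h1)
    ((((tendsto_qPoch hq _).mul (tendsto_qPoch hq _)).mul (tendsto_qPoch hq _)).mul h2)

/-- Bailey's nonterminating `₈φ₇` sum. The contiguities `d → dq` and `e → eq` reduce it to
`d = e = 0`, which is the nonterminating `q`-Chu–Vandermonde sum. -/
theorem dougSum_eq (hq : ‖q‖ < 1) (hf : f ≠ 0) (hg : g ≠ 0) (hx : x ≠ 0)
    (hz : z ≠ 0) (hfg : ∀ n : ℕ, f / g * q ^ n ≠ 1) (hgf : ∀ n : ℕ, g / f * q ^ n ≠ 1)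
    (hl : ∀ n : ℕ, d * e * g * x * z / f * q ^ n ≠ 1)
    (hl' : ∀ n : ℕ, d * e * f * x * z / g * q ^ n ≠ 1) :
    dougSum q d e f g x z = qPochInf q (-d * x) * qPochInf q (-q * d * z)
      * qPochInf q (-e * x) * qPochInf q (-q * e * z)
      * qPochInf q (d * e * f * g * x ^ 2 * z ^ 2) * qPochInf q (q / (f * g * x * z)) := by
  have h0 : dougSum q 0 0 f g x z = vanSum q f g (-q / x) (-1 / z) := by
    have h : ∀ f g n, dougTerm q 0 0 f g x z n = vanTerm q f g (-q / x) (-1 / z) n :=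
      fun f g n => by
        simp [dougTerm, vanTerm, qPochInf_zero_left, qPoch_zero_left, div_div, mul_assoc]
    simp only [dougSum, vanSum, h]
  rw [dougSum_eq_mul_dougSum_zero hq hf hg hx hz hfg hgf hl hl', dougSum_comm,
    dougSum_eq_mul_dougSum_zero hq hf hg hx hz hfg hgf (by simp) (by simp), h0,
    vanSum_eq hq hf hg hfg hgf]
  rw [show -q / x * (-1 / z) / (f * g) = q / (f * g * x * z) by field_simp]
  simp only [mul_zero, zero_mul, qPochInf_zero_left]
  ring

end Dougall

/-! ### The terminating `₆ψ₆` sum -/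

section Bilateral

variable {q p a : ℂ}

/-- The pair `(-c/X, -cqX/p; q)_∞` of infinite products belonging to one parameter `c` of a
well-poised bilateral series, as a function of the summation variable `X = a q^n`. -/
noncomputable def pairInf (q p c X : ℂ) : ℂ :=
  qPochInf q (-(c / X)) * qPochInf q (-(c * q * X / p))

theorem pairInf_zero (q p X : ℂ) : pairInf q p 0 X = 1 := by
  simp [pairInf, qPochInf_zero_left]

theorem differentiable_pairInf (hq : ‖q‖ < 1) (p X : ℂ) :
    Differentiable ℂ fun c => pairInf q p c X := by
  have h1 := differentiable_qPochInf hq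
  have h2 : Differentiable ℂ fun c : ℂ => qPochInf q (-(c / X)) := h1.comp (by fun_prop)
  have h3 : Differentiable ℂ fun c : ℂ => qPochInf q (-(c * q * X / p)) := h1.comp (by fun_prop)
  exact h2.mul h3

/-- The terms of a very-well-poised `₆ψ₆` series with all its infinite products cleared. The
symmetric parameters are `c₁, …, c₄`, and `p` plays the role of `ab`. -/
noncomputable def psi6Term (q p a c₁ c₂ c₃ c₄ : ℂ) (n : ℕ) : ℂ :=
  (1 - q * (a * q ^ n) ^ 2 / p) * ((a ^ 2 / p) ^ (2 * n) * q ^ (2 * n ^ 2 + n))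
    * (pairInf q p c₁ (a * q ^ n) * pairInf q p c₂ (a * q ^ n) * pairInf q p c₃ (a * q ^ n)
      * pairInf q p c₄ (a * q ^ n))

/-- The telescoping certificate for the contiguity `c₁ → c₁q` of `psi6Term`. -/
noncomputable def psi6Cert (q p a c₁ c₂ c₃ c₄ : ℂ) (n : ℕ) : ℂ :=
  -c₁ * ((a ^ 2 / p) ^ (2 * n) * q ^ (2 * n ^ 2 + n)) * (a * q ^ n)⁻¹
    * (qPochInf q (-(c₁ * q / (a * q ^ n))) * qPochInf q (-(c₁ * q * (a * q ^ n) / p))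
      * (qPochInf q (-(c₂ / (a * q ^ n))) * qPochInf q (-(c₂ * (a * q ^ n) / p)))
      * (qPochInf q (-(c₃ / (a * q ^ n))) * qPochInf q (-(c₃ * (a * q ^ n) / p)))
      * (qPochInf q (-(c₄ / (a * q ^ n))) * qPochInf q (-(c₄ * (a * q ^ n) / p))))

theorem psi6_certificate_identity {q p X : ℂ} (hq0 : q ≠ 0) (hp : p ≠ 0) (hX : X ≠ 0)
    (c₁ c₂ c₃ c₄ : ℂ) :
    (1 - q * X ^ 2 / p) * ((1 - c₁ * c₂ * c₃ * c₄ / (q * p ^ 2))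
        * ((1 + c₁ / X) * (1 + c₁ * q * X / p))
      - (1 - c₁ * c₂ / p) * (1 - c₁ * c₃ / p) * (1 - c₁ * c₄ / p))
    = -c₁ * (q ^ 2 * X ^ 3 / p ^ 2 * ((1 + c₁ / X) * ((1 + c₂ / (q * X)) * (1 + c₃ / (q * X))
        * (1 + c₄ / (q * X))))
      - X⁻¹ * ((1 + c₁ * q * X / p) * ((1 + c₂ * X / p) * (1 + c₃ * X / p)
        * (1 + c₄ * X / p)))) := by
  field_simp
  ring

theorem psi6Term_contiguous (hq0 : q ≠ 0) (hq : ‖q‖ < 1) (hp : p ≠ 0) (ha : a ≠ 0)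
    (c₁ c₂ c₃ c₄ : ℂ) (n : ℕ) :
    (1 - c₁ * c₂ * c₃ * c₄ / (q * p ^ 2)) * psi6Term q p a c₁ c₂ c₃ c₄ n
      - (1 - c₁ * c₂ / p) * (1 - c₁ * c₃ / p) * (1 - c₁ * c₄ / p)
        * psi6Term q p a (c₁ * q) c₂ c₃ c₄ n
      = psi6Cert q p a c₁ c₂ c₃ c₄ (n + 1) - psi6Cert q p a c₁ c₂ c₃ c₄ n := by
  have hX : a * q ^ n ≠ 0 := mul_ne_zero ha (pow_ne_zero n hq0)
  have hw : (a ^ 2 / p) ^ (2 * (n + 1)) * q ^ (2 * (n + 1) ^ 2 + (n + 1)) * (a * q ^ (n + 1))⁻¹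
      = (a ^ 2 / p) ^ (2 * n) * q ^ (2 * n ^ 2 + n) * (q ^ 2 * (a * q ^ n) ^ 3 / p ^ 2) := by
    rw [show 2 * (n + 1) ^ 2 + (n + 1) = (2 * n ^ 2 + n) + 4 * n + 3 by ring,
      show 2 * (n + 1) = 2 * n + 2 by ring, pow_add (a ^ 2 / p)]
    generalize (a ^ 2 / p) ^ (2 * n) = w
    field_simp
    ring
  have hX' : a * q ^ (n + 1) = q * (a * q ^ n) := by ring
  unfold psi6Cert
  rw [show ∀ A B C D : ℂ, -A * B * C * D = -A * (B * C) * D by intros; ring, hw, hX']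
  unfold psi6Term pairInf
  generalize (a ^ 2 / p) ^ (2 * n) * q ^ (2 * n ^ 2 + n) = w
  generalize a * q ^ n = X at hX
  have e1 : -(c₁ * q / (q * X)) = -(c₁ / X) := by field_simp
  have e2 : -(c₁ * q * (q * X) / p) = -(c₁ * q * q * X / p) := by ring
  have e3 : ∀ c : ℂ, -(c * (q * X) / p) = -(c * q * X / p) := fun c => by ring
  have s1 : qPochInf q (-(c₁ / X)) = (1 + c₁ / X) * qPochInf q (-(c₁ * q / X)) := by
    rw [qPochInf_step_of_eq hq (y := -(c₁ * q / X)) (by ring), sub_neg_eq_add]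
  have s2 : qPochInf q (-(c₁ * q * X / p))
      = (1 + c₁ * q * X / p) * qPochInf q (-(c₁ * q * q * X / p)) := by
    rw [qPochInf_step_of_eq hq (y := -(c₁ * q * q * X / p)) (by ring), sub_neg_eq_add]
  have s3 : ∀ c, qPochInf q (-(c / (q * X))) = (1 + c / (q * X)) * qPochInf q (-(c / X)) := by
    intro c
    rw [qPochInf_step_of_eq hq (y := -(c / X)) (by field_simp), sub_neg_eq_add]
  have s4 : ∀ c, qPochInf q (-(c * X / p)) = (1 + c * X / p) * qPochInf q (-(c * q * X / p)) := by
    intro c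
    rw [qPochInf_step_of_eq hq (y := -(c * q * X / p)) (by ring), sub_neg_eq_add]
  rw [e1, e2, e3 c₂, e3 c₃, e3 c₄, s1, s2, s3 c₂, s3 c₃, s3 c₄, s4 c₂, s4 c₃, s4 c₄]
  linear_combination w * (qPochInf q (-(c₁ * q / X)) * qPochInf q (-(c₁ * q * q * X / p))
    * (qPochInf q (-(c₂ / X)) * qPochInf q (-(c₂ * q * X / p)))
    * (qPochInf q (-(c₃ / X)) * qPochInf q (-(c₃ * q * X / p)))
    * (qPochInf q (-(c₄ / X)) * qPochInf q (-(c₄ * q * X / p))))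
    * psi6_certificate_identity hq0 hp hX c₁ c₂ c₃ c₄

/-- The `₆ψ₆` series restricted to `0 ≤ n < N`; the whole series if `c₁ = -a q^N` and
`c₂ = -p/a`. -/
noncomputable def psi6Sum (q p a c₁ c₂ c₃ c₄ : ℂ) (N : ℕ) : ℂ :=
  ∑ n ∈ Finset.range N, psi6Term q p a c₁ c₂ c₃ c₄ n

theorem psi6Sum_contiguous (hq0 : q ≠ 0) (hq : ‖q‖ < 1) (hp : p ≠ 0) (ha : a ≠ 0)
    (c₁ c₂ c₃ c₄ : ℂ) (N : ℕ) :
    (1 - c₁ * c₂ * c₃ * c₄ / (q * p ^ 2)) * psi6Sum q p a c₁ c₂ c₃ c₄ N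
      - (1 - c₁ * c₂ / p) * (1 - c₁ * c₃ / p) * (1 - c₁ * c₄ / p)
        * psi6Sum q p a (c₁ * q) c₂ c₃ c₄ N
      = psi6Cert q p a c₁ c₂ c₃ c₄ N - psi6Cert q p a c₁ c₂ c₃ c₄ 0 := by
  rw [← Finset.sum_range_sub, psi6Sum, psi6Sum, Finset.mul_sum, Finset.mul_sum,
    ← Finset.sum_sub_distrib]
  exact Finset.sum_congr rfl fun n _ => psi6Term_contiguous hq0 hq hp ha c₁ c₂ c₃ c₄ n

theorem qPochInf_one (hq : ‖q‖ < 1) : qPochInf q 1 = 0 := qPochInf_eq_zero hq (n := 0) (by simp)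

/-- The theta function in front of the terminating `₆ψ₆` sum. -/
noncomputable def vwpTheta (q p a : ℂ) : ℂ :=
  qPochInf q q * qPochInf q (q * a ^ 2 / p) * qPochInf q (p / a ^ 2)

theorem psi6Sum_zero_zero (hq0 : q ≠ 0) (hq : ‖q‖ < 1) (hp : p ≠ 0) (ha : a ≠ 0) (N : ℕ) :
    psi6Sum q p a (-a * q ^ (N + 1)) (-p / a) 0 0 (N + 1)
      = vwpTheta q p a * qPochInf q (q ^ (N + 1)) := by
  induction N with
  | zero =>
    have h1 : qPochInf q (q * a ^ 2 / p)
        = (1 - q * a ^ 2 / p) * qPochInf q (q ^ 2 * a ^ 2 / p) :=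
      qPochInf_step_of_eq hq (by ring)
    simp only [psi6Sum, zero_add, Finset.sum_range_one, psi6Term, pairInf_zero, pow_zero,
      mul_one, pow_one, vwpTheta, mul_zero, h1]
    unfold pairInf
    rw [show -(-a * q / a) = q by field_simp,
      show -(-a * q * q * a / p) = q ^ 2 * a ^ 2 / p by ring,
      show -(-p / a / a) = p / a ^ 2 by field_simp,
      show -(-p / a * q * a / p) = q by field_simp]
    ring
  | succ N ih =>
    have hc := psi6Sum_contiguous hq0 hq hp ha (-a * q ^ (N + 1)) (-p / a) 0 0 (N + 2)
    have hN : psi6Term q p a (-a * q ^ (N + 1)) (-p / a) 0 0 (N + 1) = 0 := by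
      have : -(-a * q ^ (N + 1) / (a * q ^ (N + 1))) = 1 := by field_simp
      simp only [psi6Term, pairInf, this, qPochInf_one hq]
      ring
    have h1 : psi6Sum q p a (-a * q ^ (N + 1)) (-p / a) 0 0 (N + 2)
        = vwpTheta q p a * qPochInf q (q ^ (N + 1)) := by
      rw [psi6Sum, Finset.sum_range_succ, hN, add_zero, ← ih, psi6Sum]
    have h2 : psi6Cert q p a (-a * q ^ (N + 1)) (-p / a) 0 0 0 = 0 := by
      have : -(-p / a * (a * q ^ 0) / p) = 1 := by field_simp
      simp only [psi6Cert, this, qPochInf_one hq]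
      ring
    have h3 : psi6Cert q p a (-a * q ^ (N + 1)) (-p / a) 0 0 (N + 2) = 0 := by
      have : -(-a * q ^ (N + 1) * q / (a * q ^ (N + 2))) = 1 := by field_simp; ring
      simp only [psi6Cert, this, qPochInf_one hq]
      ring
    have h4 : qPochInf q (q ^ (N + 1)) = (1 - q ^ (N + 1)) * qPochInf q (q ^ (N + 2)) :=
      qPochInf_step_of_eq hq (by ring)
    have h5 : 1 - q ^ (N + 1) ≠ 0 := by
      rw [pow_succ']
      exact sub_ne_zero.2 (q_mul_pow_ne_one hq N).symm
    rw [h1, h2, h3, h4, show -a * q ^ (N + 1) * (-p / a) / p = q ^ (N + 1) by field_simp,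
      show -a * q ^ (N + 1) * q = -a * q ^ (N + 1 + 1) by ring] at hc
    simp only [mul_zero, zero_div, sub_zero, one_mul, mul_one] at hc
    refine mul_left_cancel₀ h5 ?_
    linear_combination -hc

theorem psi6Sum_eq_mul_psi6Sum_zero (hq0 : q ≠ 0) (hq : ‖q‖ < 1) (hp : p ≠ 0) (ha : a ≠ 0)
    (c₃ c₄ : ℂ) (N : ℕ) :
    psi6Sum q p a (-a * q ^ N) (-p / a) c₃ c₄ N * qPochInf q (c₃ * c₄ * q ^ N / (q * p))
      = qPochInf q (-a * q ^ N * c₃ / p) * qPochInf q (-p / a * c₃ / p) * qPochInf q (c₃ * c₄ / p)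
        * psi6Sum q p a (-a * q ^ N) (-p / a) 0 c₄ N := by
  have hsymm : ∀ c c₁ c₂ : ℂ, psi6Sum q p a c₁ c₂ c c₄ N = psi6Sum q p a c c₁ c₂ c₄ N :=
    fun c c₁ c₂ => Finset.sum_congr rfl fun n _ => by unfold psi6Term; ring
  have hstep : ∀ c : ℂ, (1 - c * c₄ * q ^ N / (q * p))
        * psi6Sum q p a (-a * q ^ N) (-p / a) c c₄ N
      = (1 - -a * q ^ N * c / p) * (1 - -p / a * c / p) * (1 - c * c₄ / p)
        * psi6Sum q p a (-a * q ^ N) (-p / a) (c * q) c₄ N := by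
    intro c
    have hc := psi6Sum_contiguous hq0 hq hp ha c (-a * q ^ N) (-p / a) c₄ N
    have h2 : psi6Cert q p a c (-a * q ^ N) (-p / a) c₄ 0 = 0 := by
      have : -(-p / a * (a * q ^ 0) / p) = 1 := by field_simp
      simp only [psi6Cert, this, qPochInf_one hq]
      ring
    have h3 : psi6Cert q p a c (-a * q ^ N) (-p / a) c₄ N = 0 := by
      have : -(-a * q ^ N / (a * q ^ N)) = 1 := by field_simp
      simp only [psi6Cert, this, qPochInf_one hq]
      ring
    rw [h2, h3, ← hsymm c (-a * q ^ N), ← hsymm (c * q) (-a * q ^ N),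
      show c * (-a * q ^ N) * (-p / a) * c₄ / (q * p ^ 2)
      = c * c₄ * q ^ N / (q * p) by field_simp] at hc
    linear_combination hc
  have hiter : ∀ M : ℕ, psi6Sum q p a (-a * q ^ N) (-p / a) c₃ c₄ N
        * qPoch q (c₃ * c₄ * q ^ N / (q * p)) M
      = qPoch q (-a * q ^ N * c₃ / p) M * qPoch q (-p / a * c₃ / p) M * qPoch q (c₃ * c₄ / p) M
        * psi6Sum q p a (-a * q ^ N) (-p / a) (c₃ * q ^ M) c₄ N := by
    intro M
    induction M with
    | zero => simp [qPoch_zero]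
    | succ M ih =>
      rw [qPoch_succ, qPoch_succ, qPoch_succ, qPoch_succ, ← mul_assoc, ih,
        show c₃ * q ^ (M + 1) = c₃ * q ^ M * q by ring]
      linear_combination (qPoch q (-a * q ^ N * c₃ / p) M * qPoch q (-p / a * c₃ / p) M
        * qPoch q (c₃ * c₄ / p) M) * hstep (c₃ * q ^ M)
  have hcont : Continuous fun c => psi6Sum q p a (-a * q ^ N) (-p / a) c c₄ N := by
    have := fun X => (differentiable_pairInf hq p X).continuous
    unfold psi6Sum psi6Term
    fun_prop
  exact tendsto_nhds_unique (((tendsto_qPoch hq _).const_mul _).congr hiter)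
    ((((tendsto_qPoch hq _).mul (tendsto_qPoch hq _)).mul (tendsto_qPoch hq _)).mul
      ((hcont.tendsto 0).comp (tendsto_const_mul_pow_zero hq c₃)))

/-- The terminating `₆ψ₆` sum (Rogers' terminating `₆φ₅` sum): the contiguities `c₃ → c₃q` and
`c₄ → c₄q` reduce it to `c₃ = c₄ = 0`, and `c₁ → c₁q` reduces that case to a single term. -/
theorem psi6Sum_eq (hq0 : q ≠ 0) (hq : ‖q‖ < 1) (hp : p ≠ 0) (ha : a ≠ 0)
    (c₃ c₄ : ℂ) (N : ℕ) :
    psi6Sum q p a (-a * q ^ (N + 1)) (-p / a) c₃ c₄ (N + 1)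
        * qPochInf q (c₃ * c₄ * q ^ (N + 1) / (q * p))
      = vwpTheta q p a * qPochInf q (q ^ (N + 1)) * qPochInf q (-a * q ^ (N + 1) * c₃ / p)
        * qPochInf q (-p / a * c₃ / p) * qPochInf q (c₃ * c₄ / p)
        * qPochInf q (-a * q ^ (N + 1) * c₄ / p) * qPochInf q (-p / a * c₄ / p) := by
  have hsymm : psi6Sum q p a (-a * q ^ (N + 1)) (-p / a) 0 c₄ (N + 1)
      = psi6Sum q p a (-a * q ^ (N + 1)) (-p / a) c₄ 0 (N + 1) :=
    Finset.sum_congr rfl fun n _ => by unfold psi6Term; ring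
  have h := psi6Sum_eq_mul_psi6Sum_zero hq0 hq hp ha c₄ 0 (N + 1)
  rw [psi6Sum_zero_zero hq0 hq hp ha] at h
  simp only [mul_zero, zero_mul, zero_div, qPochInf_zero_left, mul_one] at h
  rw [psi6Sum_eq_mul_psi6Sum_zero hq0 hq hp ha, hsymm, h]
  ring

end Bilateral

/-! ### Expanding the `₈ψ₈` series -/

section Expansion

variable {q p a c₁ c₂ d e f g : ℂ}

/-- Quasi-periodicity of the theta function `(y, q/y; q)_∞` under `y → qy`. -/
theorem theta_quasiperiodic (hq0 : q ≠ 0) (hq : ‖q‖ < 1) {y : ℂ} (hy : y ≠ 0) :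
    qPochInf q (q * y) * qPochInf q (q / (q * y)) * y = -(qPochInf q y * qPochInf q (q / y)) := by
  have h1 : qPochInf q y = (1 - y) * qPochInf q (q * y) := qPochInf_step_of_eq hq (by ring)
  have h2 : qPochInf q (q / (q * y)) = (1 - q / (q * y)) * qPochInf q (q / y) :=
    qPochInf_step_of_eq hq (by field_simp)
  rw [h1, h2]
  field_simp
  ring

/-- The product of the theta functions of `-c/X` and `-cqX/p`. -/
noncomputable def thetaPair (q p c X : ℂ) : ℂ :=
  pairInf q p c X * (qPochInf q (-(q * X / c)) * qPochInf q (-(p / (c * X))))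

theorem thetaPair_step (hq0 : q ≠ 0) (hq : ‖q‖ < 1) (hp : p ≠ 0) {c X : ℂ} (hc : c ≠ 0)
    (hX : X ≠ 0) : X ^ 2 / p * q ^ 2 * thetaPair q p c (q * X) = thetaPair q p c X := by
  have h1 := theta_quasiperiodic hq0 hq (y := -(c / (q * X))) (by simp [hc, hq0, hX])
  have h2 := theta_quasiperiodic hq0 hq (y := -(c * q * X / p)) (by simp [hc, hq0, hX, hp])
  rw [show q * -(c / (q * X)) = -(c / X) by field_simp,
    show q / -(c / X) = -(q * X / c) by field_simp,
    show q / -(c / (q * X)) = -(q * (q * X) / c) by field_simp] at h1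
  rw [show q * -(c * q * X / p) = -(c * q * (q * X) / p) by ring,
    show q / -(c * q * (q * X) / p) = -(p / (c * (q * X))) by field_simp,
    show q / -(c * q * X / p) = -(p / (c * X)) by field_simp] at h2
  have e1 : qPochInf q (-(c / (q * X))) * qPochInf q (-(q * (q * X) / c))
      = qPochInf q (-(c / X)) * qPochInf q (-(q * X / c)) * (c / (q * X)) := by
    linear_combination h1
  have e2 : qPochInf q (-(c * q * X / p)) * qPochInf q (-(p / (c * X)))
      = qPochInf q (-(c * q * (q * X) / p)) * qPochInf q (-(p / (c * (q * X))))
        * (c * q * X / p) := by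
    linear_combination h2
  have e3 : thetaPair q p c (q * X) = qPochInf q (-(c / (q * X))) * qPochInf q (-(q * (q * X) / c))
      * (qPochInf q (-(c * q * (q * X) / p)) * qPochInf q (-(p / (c * (q * X))))) := by
    unfold thetaPair pairInf; ring
  have e4 : thetaPair q p c X = qPochInf q (-(c / X)) * qPochInf q (-(q * X / c))
      * (qPochInf q (-(c * q * X / p)) * qPochInf q (-(p / (c * X)))) := by
    unfold thetaPair pairInf; ring
  rw [e3, e4, e1, e2]
  field_simp

theorem thetaPair_mul_pow (hq0 : q ≠ 0) (hq : ‖q‖ < 1) (hp : p ≠ 0) (ha : a ≠ 0) {c : ℂ}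
    (hc : c ≠ 0) (k : ℕ) :
    (a ^ 2 / p) ^ k * q ^ (k ^ 2 + k) * thetaPair q p c (a * q ^ k) = thetaPair q p c a := by
  induction k with
  | zero => simp
  | succ k ih =>
    rw [← ih, ← thetaPair_step hq0 hq hp hc (X := a * q ^ k) (by simp [ha, hq0]),
      show a * q ^ (k + 1) = q * (a * q ^ k) by ring]
    ring

theorem two_mul_choose_succ_two (m : ℕ) : (m + 1).choose 2 + (m + 1).choose 2 = m ^ 2 + m := by
  rw [Nat.choose_two_right, Nat.add_sub_cancel, ← two_mul,
    Nat.mul_div_cancel' (by rw [mul_comm]; exact (Nat.even_mul_succ_self m).two_dvd)]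
  ring

theorem pairInf_div_pow (hq0 : q ≠ 0) (hq : ‖q‖ < 1) (hp : p ≠ 0) {c X : ℂ} (hc : c ≠ 0)
    (hX : X ≠ 0) (m : ℕ) :
    pairInf q p c X * (qPoch q (-(q * X / c)) m * qPoch q (-(p / (c * X))) m)
      = (p / c ^ 2) ^ m * q ^ (m ^ 2) * pairInf q p (c / q ^ m) X := by
  have h1 := qPochInf_div_pow hq0 hq (-(c / X)) m
  have h2 := qPochInf_div_pow hq0 hq (-(c * q * X / p)) m
  rw [qDesc_eq_qPoch (by simp [hc, hX])] at h1
  rw [qDesc_eq_qPoch (by simp [hc, hX, hp, hq0])] at h2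
  rw [neg_neg, show q / -(c / X) = -(q * X / c) by field_simp,
    show -(c / X) / q ^ m = -(c / q ^ m / X) by field_simp] at h1
  rw [neg_neg, show q / -(c * q * X / p) = -(p / (c * X)) by field_simp,
    show -(c * q * X / p) / q ^ m = -(c / q ^ m * q * X / p) by field_simp] at h2
  have h3 : q ^ ((m + 1).choose 2) * q ^ ((m + 1).choose 2) = q ^ (m ^ 2) * q ^ m := by
    rw [← pow_add, ← pow_add, two_mul_choose_succ_two]
  have h4 : (p / c ^ 2) ^ m * ((c / X) ^ m * (c * q * X / p) ^ m) = q ^ m := by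
    rw [← mul_pow, ← mul_pow]
    congr 1
    field_simp
  have h5 : q ^ m ≠ 0 := pow_ne_zero m hq0
  refine mul_left_cancel₀ h5 ?_
  unfold pairInf
  calc _ = (p / c ^ 2) ^ m * (((c / X) ^ m * qPoch q (-(q * X / c)) m * qPochInf q (-(c / X)))
        * ((c * q * X / p) ^ m * qPoch q (-(p / (c * X))) m * qPochInf q (-(c * q * X / p)))) := by
        rw [← h4]; ring
    _ = _ := by rw [← h1, ← h2]; linear_combination ((p / c ^ 2) ^ m
        * qPochInf q (-(c / q ^ m / X)) * qPochInf q (-(c / q ^ m * q * X / p))) * h3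

/-- The terms of index `n ≥ 0` of the very-well-poised `₈ψ₈` series with all its infinite products
cleared. It is symmetric in the six parameters. -/
noncomputable def psi8Term (q p a c₁ c₂ d e f g : ℂ) (n : ℕ) : ℂ :=
  (1 - q * (a * q ^ n) ^ 2 / p) * ((a ^ 2 / p) ^ (3 * n) * q ^ (3 * n ^ 2 + 2 * n))
    * (pairInf q p c₁ (a * q ^ n) * pairInf q p c₂ (a * q ^ n) * pairInf q p d (a * q ^ n)
      * pairInf q p e (a * q ^ n) * pairInf q p f (a * q ^ n) * pairInf q p g (a * q ^ n))

/-- The terms of the very-well-poised `₈φ₇` series with base parameter `λ = deg/pf`, multiplied by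
its infinite products so as to be entire in `c₁` and `c₂`. -/
noncomputable def phi8Term (q p c₁ c₂ d e f g : ℂ) (m : ℕ) : ℂ :=
  (1 - d * e * g / (p * f) * q ^ (2 * m)) * (p / f ^ 2) ^ m * qPoch q (d * e / p) m
    * qPoch q (d * g / p) m * qPoch q (e * g / p) m
    * qDesc q (c₁ * f / p) m * qDesc q (c₂ * f / p) m
    * qPochInf q (q * e / f * q ^ m) * qPochInf q (q * d / f * q ^ m)
    * qPochInf q (c₁ * (d * e * g) / p ^ 2 * q ^ m) * qPochInf q (c₂ * (d * e * g) / p ^ 2 * q ^ m)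
    * (qPochInf q (c₁ * c₂ / p) * qPochInf q (c₁ * f / p) * qPochInf q (c₂ * f / p)
      * qPochInf q (d * f / p) * qPochInf q (e * f / p))
    / (qPochInf q (d * e * g / (p * f) * q ^ m) * qPoch q q m
      * (qPochInf q (f / g) * qPoch q (q * g / f) m))

/-- The part of `phi8Term` that does not involve `c₁` and `c₂`. -/
noncomputable def phi8Coeff (q p d e f g : ℂ) (m : ℕ) : ℂ :=
  q ^ m * (1 - d * e * g / (p * f) * q ^ (2 * m)) * ((p / f ^ 2) ^ m * q ^ (m ^ 2))
    * qPoch q (d * e / p) m * qPoch q (d * g / p) m * qPoch q (e * g / p) m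
    * qPochInf q (q * e / f * q ^ m) * qPochInf q (q * d / f * q ^ m)
    * (qPochInf q (d * f / p) * qPochInf q (e * f / p))
    / (qPochInf q (d * e * g / (p * f) * q ^ m) * qPoch q q m
      * (qPochInf q (f / g) * qPoch q (q * g / f) m))

theorem phi8Coeff_mul (hq0 : q ≠ 0) (hq : ‖q‖ < 1) (p c₁ c₂ d e f g : ℂ) (m : ℕ) :
    phi8Coeff q p d e f g m * (qPochInf q (c₁ * c₂ / p) * qPochInf q (c₁ * (f / q ^ m) / p)
        * qPochInf q (c₂ * (f / q ^ m) / p) * qPochInf q (c₁ * (d * e * g / p * q ^ m) / p)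
        * qPochInf q (c₂ * (d * e * g / p * q ^ m) / p))
      = phi8Term q p c₁ c₂ d e f g m := by
  have h1 := qPochInf_div_pow hq0 hq (c₁ * f / p) m
  have h2 := qPochInf_div_pow hq0 hq (c₂ * f / p) m
  have h3 : q ^ ((m + 1).choose 2) * q ^ ((m + 1).choose 2) = q ^ (m ^ 2) * q ^ m := by
    rw [← pow_add, ← pow_add, two_mul_choose_succ_two]
  have h4 : qDesc q (c₁ * f / p) m * qPochInf q (c₁ * f / p)
      * (qDesc q (c₂ * f / p) m * qPochInf q (c₂ * f / p))
      = q ^ (m ^ 2) * q ^ m * qPochInf q (c₁ * (f / q ^ m) / p)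
        * qPochInf q (c₂ * (f / q ^ m) / p) := by
    rw [← h1, ← h2, ← h3, show c₁ * f / p / q ^ m = c₁ * (f / q ^ m) / p by ring,
      show c₂ * f / p / q ^ m = c₂ * (f / q ^ m) / p by ring]
    ring
  have h5 : ∀ c, c * (d * e * g / p * q ^ m) / p = c * (d * e * g) / p ^ 2 * q ^ m :=
    fun c => by ring
  rw [h5, h5]
  unfold phi8Coeff phi8Term
  rw [div_mul_eq_mul_div]
  congr 1
  linear_combination -((1 - d * e * g / (p * f) * q ^ (2 * m)) * (p / f ^ 2) ^ m
    * qPoch q (d * e / p) m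
    * qPoch q (d * g / p) m * qPoch q (e * g / p) m
    * qPochInf q (q * e / f * q ^ m) * qPochInf q (q * d / f * q ^ m)
    * qPochInf q (c₁ * (d * e * g) / p ^ 2 * q ^ m) * qPochInf q (c₂ * (d * e * g) / p ^ 2 * q ^ m)
    * (qPochInf q (c₁ * c₂ / p) * qPochInf q (d * f / p) * qPochInf q (e * f / p))) * h4

/-- One term of the `₈φ₇` expansion of the `d` and `e` factors, inserted into the `k`-th term of the
`₈ψ₈` series, is a multiple of the `k`-th term of a `₆ψ₆` series with parameters
`c₁, c₂, f q^{-m}, (deg/p) q^m`. -/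
theorem dougTerm_mul_eq_psi6Term (hq0 : q ≠ 0) (hq : ‖q‖ < 1) (hp : p ≠ 0) (ha : a ≠ 0)
    (hf : f ≠ 0) (hg : g ≠ 0) (c₁ c₂ d e : ℂ) (k m : ℕ) :
    (1 - q * (a * q ^ k) ^ 2 / p) * ((a ^ 2 / p) ^ (3 * k) * q ^ (3 * k ^ 2 + 2 * k))
      * (pairInf q p c₁ (a * q ^ k) * pairInf q p c₂ (a * q ^ k) * pairInf q p f (a * q ^ k)
        * pairInf q p g (a * q ^ k)) * dougTerm q d e f g (1 / (a * q ^ k)) (a * q ^ k / p) m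
    = thetaPair q p g a * (phi8Coeff q p d e f g m
      * psi6Term q p a c₁ c₂ (f / q ^ m) (d * e * g / p * q ^ m) k) := by
  have hX : a * q ^ k ≠ 0 := mul_ne_zero ha (pow_ne_zero k hq0)
  have h1 := pairInf_div_pow hq0 hq hp hf hX m
  have h2 := thetaPair_mul_pow hq0 hq hp ha hg k
  have h3 : (a ^ 2 / p) ^ (3 * k) * q ^ (3 * k ^ 2 + 2 * k)
      = (a ^ 2 / p) ^ (2 * k) * q ^ (2 * k ^ 2 + k) * ((a ^ 2 / p) ^ k * q ^ (k ^ 2 + k)) := by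
    ring
  rw [← h2, h3]
  unfold thetaPair dougTerm phi8Coeff psi6Term
  generalize (a ^ 2 / p) ^ k * q ^ (k ^ 2 + k) = w
  generalize (a ^ 2 / p) ^ (2 * k) * q ^ (2 * k ^ 2 + k) = w'
  generalize a * q ^ k = X at hX h1
  have hxz : ∀ u v : ℂ, u * v * (1 / X) * (X / p) = u * v / p := fun u v => by field_simp
  have e1 : d * e * g * (1 / X) * (X / p) / f = d * e * g / (p * f) := by field_simp
  have e2 : -q / (1 / X * f) = -(q * X / f) := by field_simp
  have e3 : -1 / (X / p * f) = -(p / (f * X)) := by field_simp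
  have e2' : -q / (1 / X * g) = -(q * X / g) := by field_simp
  have e3' : -1 / (X / p * g) = -(p / (g * X)) := by field_simp
  have e4 : qPochInf q (-(d * e * g * (1 / X) ^ 2 * (X / p)) * q ^ m)
      * qPochInf q (-(q * d * e * g * (1 / X) * (X / p) ^ 2) * q ^ m)
      = pairInf q p (d * e * g / p * q ^ m) X := by
    unfold pairInf
    congr 2 <;> field_simp
  rw [e1, hxz d e, hxz d g, hxz e g, hxz d f, hxz e f, e2, e3, e2', e3', ← e4]
  generalize qPochInf q (-(d * e * g * (1 / X) ^ 2 * (X / p)) * q ^ m) = A1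
  generalize qPochInf q (-(q * d * e * g * (1 / X) * (X / p) ^ 2) * q ^ m) = A2
  linear_combination ((1 - q * X ^ 2 / p) * (w' * w) * pairInf q p c₁ X * pairInf q p c₂ X
    * pairInf q p g X * q ^ m * (1 - d * e * g / (p * f) * q ^ (2 * m))
    * qPoch q (d * e / p) m * qPoch q (d * g / p) m * qPoch q (e * g / p) m
    * qPochInf q (q * e / f * q ^ m) * qPochInf q (q * d / f * q ^ m) * A1 * A2
    * (qPochInf q (d * f / p) * qPochInf q (e * f / p) * qPochInf q (-(q * X / g))
      * qPochInf q (-(p / (g * X))))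
    / (qPochInf q (d * e * g / (p * f) * q ^ m) * qPoch q q m
      * (qPochInf q (f / g) * qPoch q (q * g / f) m))) * h1

theorem psi8Term_mul_eq_tsum (hq0 : q ≠ 0) (hq : ‖q‖ < 1) (hp : p ≠ 0) (ha : a ≠ 0)
    (hf : f ≠ 0) (hg : g ≠ 0)
    (hfg : ∀ n : ℕ, f / g * q ^ n ≠ 1) (hgf : ∀ n : ℕ, g / f * q ^ n ≠ 1)
    (hl : ∀ n : ℕ, d * e * g / (p * f) * q ^ n ≠ 1)
    (hl' : ∀ n : ℕ, d * e * f / (p * g) * q ^ n ≠ 1) (c₁ c₂ : ℂ) (k : ℕ) :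
    psi8Term q p a c₁ c₂ d e f g k
        * (qPochInf q (d * e * f * g / p ^ 2) * qPochInf q (q * p / (f * g)))
      = ∑' m, thetaPair q p g a * (phi8Coeff q p d e f g m
          * psi6Term q p a c₁ c₂ (f / q ^ m) (d * e * g / p * q ^ m) k)
        + ∑' m, thetaPair q p f a * (phi8Coeff q p d e g f m
          * psi6Term q p a c₁ c₂ (g / q ^ m) (d * e * f / p * q ^ m) k) := by
  have hX : a * q ^ k ≠ 0 := mul_ne_zero ha (pow_ne_zero k hq0)
  have hD := dougSum_eq (d := d) (e := e) hq hf hg (one_div_ne_zero hX) (div_ne_zero hX hp) hfg hgf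
    (by
      rwa [show d * e * g * (1 / (a * q ^ k)) * (a * q ^ k / p) / f = d * e * g / (p * f) by
        field_simp])
    (by
      rwa [show d * e * f * (1 / (a * q ^ k)) * (a * q ^ k / p) / g = d * e * f / (p * g) by
        field_simp])
  simp only [← dougTerm_mul_eq_psi6Term hq0 hq hp ha hf hg c₁ c₂ d e k,
    ← dougTerm_mul_eq_psi6Term hq0 hq hp ha hg hf c₁ c₂ d e k, tsum_mul_left]
  unfold dougSum at hD
  have e1 : ∀ c X : ℂ, qPochInf q (-c * (1 / X)) * qPochInf q (-q * c * (X / p))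
      = pairInf q p c X := by
    intro c X
    unfold pairInf
    congr 2 <;> ring
  have e2 : d * e * f * g * (1 / (a * q ^ k)) ^ 2 * (a * q ^ k / p) ^ 2
      = d * e * f * g / p ^ 2 := by
    field_simp
  have e3 : q / (f * g * (1 / (a * q ^ k)) * (a * q ^ k / p)) = q * p / (f * g) := by
    field_simp
  rw [e1, mul_assoc (pairInf q p d _), e1, e2, e3] at hD
  unfold psi8Term
  linear_combination -((1 - q * (a * q ^ k) ^ 2 / p)
    * ((a ^ 2 / p) ^ (3 * k) * q ^ (3 * k ^ 2 + 2 * k))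
      * (pairInf q p c₁ (a * q ^ k) * pairInf q p c₂ (a * q ^ k) * pairInf q p f (a * q ^ k)
        * pairInf q p g (a * q ^ k))) * hD

end Expansion

/-! ### The identity for a terminating `₈ψ₈` series -/

section Terminating

variable {q p a c₁ c₂ d e f g : ℂ}

theorem ratioAt_phi8Term (hq : ‖q‖ < 1) (hf : f ≠ 0) (hp : p ≠ 0) (e g : ℂ) (t : ℂ × ℂ × ℂ) :
    RatioAt q (fun n (t : ℂ × ℂ × ℂ) => phi8Term q p t.1 t.2.1 t.2.2 e f g n) t
      (t.1 * t.2.1 / p) := by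
  have := ((((((((((((RatioAt.of_one_sub (w := fun t : ℂ × ℂ × ℂ => t.2.2 * e * g / (p * f))
      (t₀ := t) hq (by fun_prop)).mul
    (RatioAt.of_pow (q := q) (w := fun _ : ℂ × ℂ × ℂ => p / f ^ 2) continuousAt_const)).mul
    (RatioAt.of_qPoch (w := fun t : ℂ × ℂ × ℂ => t.2.2 * e / p) (by fun_prop))).mul
    (RatioAt.of_qPoch (w := fun t : ℂ × ℂ × ℂ => t.2.2 * g / p) (by fun_prop))).mul
    (RatioAt.of_qPoch (w := fun _ : ℂ × ℂ × ℂ => e * g / p) (by fun_prop))).mul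
    (RatioAt.of_qDesc (w := fun t : ℂ × ℂ × ℂ => t.1 * f / p) (by fun_prop))).mul
    (RatioAt.of_qDesc (w := fun t : ℂ × ℂ × ℂ => t.2.1 * f / p) (by fun_prop))).mul
    (RatioAt.of_qPochInf (w := fun _ : ℂ × ℂ × ℂ => q * e / f) hq (by fun_prop))).mul
    (RatioAt.of_qPochInf (w := fun t : ℂ × ℂ × ℂ => q * t.2.2 / f) hq (by fun_prop))).mul
    (RatioAt.of_qPochInf (w := fun t : ℂ × ℂ × ℂ => t.1 * (t.2.2 * e * g) / p ^ 2) hq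
      (by fun_prop))).mul
    (RatioAt.of_qPochInf (w := fun t : ℂ × ℂ × ℂ => t.2.1 * (t.2.2 * e * g) / p ^ 2) hq
      (by fun_prop))).mul
    (RatioAt.of_const fun t : ℂ × ℂ × ℂ => qPochInf q (t.1 * t.2.1 / p) * qPochInf q (t.1 * f / p)
      * qPochInf q (t.2.1 * f / p) * qPochInf q (t.2.2 * f / p) * qPochInf q (e * f / p))).div
    (((RatioAt.of_qPochInf (w := fun t : ℂ × ℂ × ℂ => t.2.2 * e * g / (p * f)) hq
      (by fun_prop)).mul
    (RatioAt.of_qPoch (w := fun _ : ℂ × ℂ × ℂ => q) (by fun_prop))).mul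
    ((RatioAt.of_const fun _ : ℂ × ℂ × ℂ => qPochInf q (f / g)).mul
    (RatioAt.of_qPoch (w := fun _ : ℂ × ℂ × ℂ => q * g / f) (by fun_prop)))) (by simp)
  have hl : t.1 * t.2.1 / p = 1 * (p / f ^ 2) * 1 * 1 * 1 * -(t.1 * f / p) * -(t.2.1 * f / p)
      * 1 * 1 * 1 * 1 * 1 / (1 * 1 * (1 * 1)) := by
    field_simp
  rw [hl]
  exact this

theorem continuousAt_tsum_phi8Term (hq : ‖q‖ < 1) (hp : p ≠ 0) (hf : f ≠ 0)
    (hfg : ∀ n : ℕ, f / g * q ^ n ≠ 1) (hgf : ∀ n : ℕ, g / f * q ^ n ≠ 1)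
    (hl : ∀ n : ℕ, d * e * g / (p * f) * q ^ n ≠ 1) (hc : ‖c₁ * c₂ / p‖ < 1) :
    ContinuousAt (fun d => ∑' m, phi8Term q p c₁ c₂ d e f g m) d := by
  have hr : RatioAt q (fun n d => phi8Term q p c₁ c₂ d e f g n) d (c₁ * c₂ / p) :=
    (ratioAt_phi8Term hq hf hp e g (c₁, c₂, d)).comp (φ := fun d : ℂ => (c₁, c₂, d))
      (by fun_prop)
  refine hr.continuousAt_tsum hq hc fun n => ?_
  have h1 : Continuous fun x => qPoch q x n := (differentiable_qPoch q n).continuous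
  have h2 := continuous_qPochInf hq
  have h3 : Continuous fun d => qPoch q (d * e / p) n := h1.comp (by fun_prop)
  have h4 : Continuous fun d => qPoch q (d * g / p) n := h1.comp (by fun_prop)
  unfold phi8Term
  refine ContinuousAt.div (by fun_prop) (by fun_prop) ?_
  have n1 : qPochInf q (d * e * g / (p * f) * q ^ n) ≠ 0 := qPochInf_ne_zero hq fun m => by
    rw [mul_assoc, ← pow_add]
    exact hl _
  have n2 : qPoch q q n ≠ 0 := qPoch_ne_zero (q_mul_pow_ne_one hq) n
  have n3 : qPoch q (q * g / f) n ≠ 0 := qPoch_ne_zero (by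
    rw [mul_div_assoc]; exact mul_q_mul_pow_ne_one hgf) n
  have n4 : qPochInf q (f / g) ≠ 0 := qPochInf_ne_zero hq hfg
  exact mul_ne_zero (mul_ne_zero n1 n2) (mul_ne_zero n4 n3)

theorem countable_setOf_mul_pow_eq_one (q κ : ℂ) :
    {d : ℂ | ∃ n : ℕ, d * κ * q ^ n = 1}.Countable := by
  rw [Set.ofPred_exists]
  refine Set.countable_iUnion fun n => Set.Subsingleton.countable fun x hx y hy => ?_
  have hx' : x * (κ * q ^ n) = 1 := by rw [← mul_assoc]; exact hx
  have hy' : y * (κ * q ^ n) = 1 := by rw [← mul_assoc]; exact hy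
  exact mul_right_cancel₀ (right_ne_zero_of_mul_eq_one hx') (hx'.trans hy'.symm)

theorem summable_phi8Coeff_mul_psi6Term (hq0 : q ≠ 0) (hq : ‖q‖ < 1) (hp : p ≠ 0) (ha : a ≠ 0)
    (hf : f ≠ 0) (hg : g ≠ 0) (c₁ c₂ d e : ℂ) (k : ℕ) :
    Summable fun m => thetaPair q p g a * (phi8Coeff q p d e f g m
      * psi6Term q p a c₁ c₂ (f / q ^ m) (d * e * g / p * q ^ m) k) := by
  simp only [← dougTerm_mul_eq_psi6Term hq0 hq hp ha hf hg c₁ c₂ d e k]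
  exact (summable_dougTerm hq d e f g _ _).mul_left _

theorem phi8Coeff_mul_psi6Sum (hq0 : q ≠ 0) (hq : ‖q‖ < 1) (hp : p ≠ 0) (ha : a ≠ 0)
    (hf : f ≠ 0) (d e g : ℂ) (N m : ℕ) :
    phi8Coeff q p d e f g m * psi6Sum q p a (-a * q ^ (N + 1)) (-p / a) (f / q ^ m)
        (d * e * g / p * q ^ m) (N + 1) * qPochInf q (d * e * f * g / p ^ 2 * q ^ N)
      = vwpTheta q p a * qPochInf q (d * e * f * g / p ^ 2)
        * phi8Term q p (-a * q ^ (N + 1)) (-p / a) d e f g m := by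
  have h1 := psi6Sum_eq hq0 hq hp ha (f / q ^ m) (d * e * g / p * q ^ m) N
  have h2 := phi8Coeff_mul hq0 hq p (-a * q ^ (N + 1)) (-p / a) d e f g m
  rw [show f / q ^ m * (d * e * g / p * q ^ m) * q ^ (N + 1) / (q * p)
      = d * e * f * g / p ^ 2 * q ^ N by field_simp; ring,
    show f / q ^ m * (d * e * g / p * q ^ m) / p = d * e * f * g / p ^ 2 by field_simp] at h1
  rw [show -a * q ^ (N + 1) * (-p / a) / p = q ^ (N + 1) by field_simp] at h2
  rw [mul_assoc, h1, ← h2]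
  ring

/-- The expansion of the eight-parameter series summed termwise by the terminating `₆ψ₆` sum,
before cancelling the common factor `(defg/p²; q)_∞`. -/
theorem sum_psi8Term_mul (hq0 : q ≠ 0) (hq : ‖q‖ < 1) (hp : p ≠ 0) (ha : a ≠ 0)
    (hf : f ≠ 0) (hg : g ≠ 0)
    (hfg : ∀ n : ℕ, f / g * q ^ n ≠ 1) (hgf : ∀ n : ℕ, g / f * q ^ n ≠ 1)
    (hl : ∀ n : ℕ, d * e * g / (p * f) * q ^ n ≠ 1)
    (hl' : ∀ n : ℕ, d * e * f / (p * g) * q ^ n ≠ 1) (N : ℕ) :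
    (∑ k ∈ Finset.range (N + 1), psi8Term q p a (-a * q ^ (N + 1)) (-p / a) d e f g k)
        * (qPochInf q (d * e * f * g / p ^ 2) * qPochInf q (q * p / (f * g)))
        * qPochInf q (d * e * f * g / p ^ 2 * q ^ N)
      = vwpTheta q p a * qPochInf q (d * e * f * g / p ^ 2)
        * (thetaPair q p g a * ∑' m, phi8Term q p (-a * q ^ (N + 1)) (-p / a) d e f g m
          + thetaPair q p f a * ∑' m, phi8Term q p (-a * q ^ (N + 1)) (-p / a) d e g f m) := by
  have hs := fun k (_ : k ∈ Finset.range (N + 1)) =>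
    summable_phi8Coeff_mul_psi6Term hq0 hq hp ha hf hg (-a * q ^ (N + 1)) (-p / a) d e k
  have hs' := fun k (_ : k ∈ Finset.range (N + 1)) =>
    summable_phi8Coeff_mul_psi6Term hq0 hq hp ha hg hf (-a * q ^ (N + 1)) (-p / a) d e k
  rw [Finset.sum_mul, Finset.sum_congr rfl fun k _ =>
    psi8Term_mul_eq_tsum hq0 hq hp ha hf hg hfg hgf hl hl' (-a * q ^ (N + 1)) (-p / a) k,
    Finset.sum_add_distrib, ← Summable.tsum_finsetSum hs, ← Summable.tsum_finsetSum hs']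
  simp only [← Finset.mul_sum, tsum_mul_left]
  have e1 := fun m => phi8Coeff_mul_psi6Sum hq0 hq hp ha hf d e g N m
  have e2 := fun m => phi8Coeff_mul_psi6Sum hq0 hq hp ha hg d e f N m
  unfold psi6Sum at e1 e2
  rw [show d * e * g * f = d * e * f * g by ring] at e2
  rw [add_mul, mul_assoc, mul_assoc (thetaPair q p f a), ← tsum_mul_right, ← tsum_mul_right]
  simp only [e1, e2, tsum_mul_left]
  ring

theorem differentiable_psi8Term_d (hq : ‖q‖ < 1) (p a c₁ c₂ e f g : ℂ) (n : ℕ) :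
    Differentiable ℂ fun d => psi8Term q p a c₁ c₂ d e f g n := by
  have h := differentiable_pairInf hq p (a * q ^ n)
  unfold psi8Term
  fun_prop

/-- The eight-parameter identity when two parameters make the series terminate. -/
theorem sum_psi8Term_eq (hq0 : q ≠ 0) (hq : ‖q‖ < 1) (hp : p ≠ 0) (ha : a ≠ 0)
    (hf : f ≠ 0) (hg : g ≠ 0)
    (hfg : ∀ n : ℕ, f / g * q ^ n ≠ 1) (hgf : ∀ n : ℕ, g / f * q ^ n ≠ 1)
    (hl : ∀ n : ℕ, d * e * g / (p * f) * q ^ n ≠ 1)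
    (hl' : ∀ n : ℕ, d * e * f / (p * g) * q ^ n ≠ 1) (N : ℕ) :
    (∑ k ∈ Finset.range (N + 1), psi8Term q p a (-a * q ^ (N + 1)) (-p / a) d e f g k)
        * qPochInf q (q * p / (f * g)) * qPochInf q (d * e * f * g / p ^ 2 * q ^ N)
      = vwpTheta q p a
        * (thetaPair q p g a * ∑' m, phi8Term q p (-a * q ^ (N + 1)) (-p / a) d e f g m
          + thetaPair q p f a * ∑' m, phi8Term q p (-a * q ^ (N + 1)) (-p / a) d e g f m) := by
  -- The factor `(defg/p²; q)_∞` can be cancelled except for countably many `d`, and both sides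
  -- are continuous in `d`.
  set S : Set ℂ := ({d | ∃ n : ℕ, d * (e * g / (p * f)) * q ^ n = 1}
    ∪ {d | ∃ n : ℕ, d * (e * f / (p * g)) * q ^ n = 1}
    ∪ {d | ∃ n : ℕ, d * (e * f * g / p ^ 2) * q ^ n = 1})ᶜ with hS
  have hdense : Dense S := Set.Countable.dense_compl ℂ
    (((countable_setOf_mul_pow_eq_one q _).union (countable_setOf_mul_pow_eq_one q _)).union
      (countable_setOf_mul_pow_eq_one q _))
  have hcc : ‖-a * q ^ (N + 1) * (-p / a) / p‖ < 1 := by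
    rw [show -a * q ^ (N + 1) * (-p / a) / p = q ^ (N + 1) by field_simp, norm_pow]
    exact pow_lt_one₀ (norm_nonneg q) hq (by omega)
  have hne : (𝓝[S] d).NeBot := mem_closure_iff_nhdsWithin_neBot.1 (hdense d)
  have c1 := continuousAt_tsum_phi8Term hq hp hf hfg hgf hl hcc
  have c2 := continuousAt_tsum_phi8Term hq hp hg hgf hfg hl' hcc
  have c3 := fun k => (differentiable_psi8Term_d hq p a (-a * q ^ (N + 1)) (-p / a)
    e f g k).continuous
  have c4 := continuous_qPochInf hq
  have hL : ContinuousAt (fun d => (∑ k ∈ Finset.range (N + 1),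
        psi8Term q p a (-a * q ^ (N + 1)) (-p / a) d e f g k)
      * qPochInf q (q * p / (f * g)) * qPochInf q (d * e * f * g / p ^ 2 * q ^ N)) d :=
    (((continuous_finsetSum _ fun k _ => c3 k).mul continuous_const).mul
      (c4.comp (by fun_prop))).continuousAt
  have hR : ContinuousAt (fun d => vwpTheta q p a
      * (thetaPair q p g a * ∑' m, phi8Term q p (-a * q ^ (N + 1)) (-p / a) d e f g m
        + thetaPair q p f a * ∑' m, phi8Term q p (-a * q ^ (N + 1)) (-p / a) d e g f m)) d :=
    continuousAt_const.mul ((continuousAt_const.mul c1).add (continuousAt_const.mul c2))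
  refine tendsto_nhds_unique_of_eventuallyEq (l := 𝓝[S] d) (hL.tendsto.mono_left nhdsWithin_le_nhds)
    (hR.tendsto.mono_left nhdsWithin_le_nhds) ?_
  filter_upwards [self_mem_nhdsWithin] with x hx
  simp only [hS, Set.mem_compl_iff, Set.mem_union, Set.mem_ofPred_eq, not_or, not_exists] at hx
  have hx1 : ∀ n : ℕ, x * e * g / (p * f) * q ^ n ≠ 1 := by
    simpa only [mul_div_assoc, mul_assoc] using hx.1.1
  have hx2 : ∀ n : ℕ, x * e * f / (p * g) * q ^ n ≠ 1 := by
    simpa only [mul_div_assoc, mul_assoc] using hx.1.2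
  have hx3 : qPochInf q (x * e * f * g / p ^ 2) ≠ 0 := by
    refine qPochInf_ne_zero hq ?_
    simpa only [mul_div_assoc, mul_assoc] using hx.2
  have h := sum_psi8Term_mul hq0 hq hp ha hf hg hfg hgf hx1 hx2 N
  refine mul_left_cancel₀ hx3 ?_
  linear_combination h

end Terminating

/-! ### The bilateral series and its quasi-periodicity -/

section Bilateral

variable {q p a c₁ c₂ d e f g : ℂ}

theorem psi8Term_comm (q p a c₁ c₂ d e f g : ℂ) (n : ℕ) :
    psi8Term q p a c₁ c₂ d e f g n = psi8Term q p a c₂ c₁ d e f g n := by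
  unfold psi8Term
  ring

theorem phi8Term_comm (q p c₁ c₂ d e f g : ℂ) (n : ℕ) :
    phi8Term q p c₁ c₂ d e f g n = phi8Term q p c₂ c₁ d e f g n := by
  unfold phi8Term
  rw [mul_comm c₁ c₂]
  ring

theorem pairInf_mul_pow (hq0 : q ≠ 0) (hq : ‖q‖ < 1) (p a c : ℂ) (n : ℕ) :
    q ^ ((n + 1).choose 2) * pairInf q p c (a * q ^ n)
      = qDesc q (-(c / a)) n * qPochInf q (-(c * q * a / p) * q ^ n) * qPochInf q (-(c / a)) := by
  have h := qPochInf_div_pow hq0 hq (-(c / a)) n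
  rw [show -(c / a) / q ^ n = -(c / (a * q ^ n)) by rw [neg_div, div_div]] at h
  unfold pairInf
  rw [show -(c * q * (a * q ^ n) / p) = -(c * q * a / p) * q ^ n by ring]
  linear_combination qPochInf q (-(c * q * a / p) * q ^ n) * h

theorem psi8Term_eq (hq0 : q ≠ 0) (hq : ‖q‖ < 1) (p a c₁ c₂ d e f g : ℂ) (n : ℕ) :
    psi8Term q p a c₁ c₂ d e f g n = (1 - q * a ^ 2 / p * q ^ (2 * n)) * (q⁻¹ * (a ^ 2 / p) ^ 3) ^ n
      * (qDesc q (-(c₁ / a)) n * qPochInf q (-(c₁ * q * a / p) * q ^ n) * qPochInf q (-(c₁ / a)))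
      * (qDesc q (-(c₂ / a)) n * qPochInf q (-(c₂ * q * a / p) * q ^ n) * qPochInf q (-(c₂ / a)))
      * (qDesc q (-(d / a)) n * qPochInf q (-(d * q * a / p) * q ^ n) * qPochInf q (-(d / a)))
      * (qDesc q (-(e / a)) n * qPochInf q (-(e * q * a / p) * q ^ n) * qPochInf q (-(e / a)))
      * (qDesc q (-(f / a)) n * qPochInf q (-(f * q * a / p) * q ^ n) * qPochInf q (-(f / a)))
      * (qDesc q (-(g / a)) n * qPochInf q (-(g * q * a / p) * q ^ n)
        * qPochInf q (-(g / a))) := by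
  simp only [← pairInf_mul_pow hq0 hq]
  have h : q ^ (3 * n ^ 2 + 2 * n)
      = q⁻¹ ^ n * (q ^ ((n + 1).choose 2) * q ^ ((n + 1).choose 2)) ^ 3 := by
    rw [← pow_add, two_mul_choose_succ_two, inv_pow, eq_inv_mul_iff_mul_eq₀ (pow_ne_zero n hq0)]
    ring
  unfold psi8Term
  rw [h]
  ring

theorem ratioAt_psi8Term (hq0 : q ≠ 0) (hq : ‖q‖ < 1) (ha : a ≠ 0) (c₂ d e f g c₁ : ℂ) :
    RatioAt q (fun n c₁ => psi8Term q p a c₁ c₂ d e f g n) c₁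
      (c₁ * c₂ * d * e * f * g / (q * p ^ 3)) := by
  have hpair : ∀ w : ℂ → ℂ, ContinuousAt w c₁ →
      RatioAt q (fun n t => qDesc q (-(w t / a)) n * qPochInf q (-(w t * q * a / p) * q ^ n)
        * qPochInf q (-(w t / a))) c₁ (-(-(w c₁ / a)) * 1 * 1) := fun w hw =>
    ((RatioAt.of_qDesc (w := fun t => -(w t / a)) (by fun_prop)).mul
      (RatioAt.of_qPochInf (w := fun t => -(w t * q * a / p)) hq (by fun_prop))).mul
      (RatioAt.of_const fun t => qPochInf q (-(w t / a)))
  have := (((((((RatioAt.of_one_sub (w := fun _ : ℂ => q * a ^ 2 / p) (t₀ := c₁) hq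
      (by fun_prop)).mul
    (RatioAt.of_pow (w := fun _ : ℂ => q⁻¹ * (a ^ 2 / p) ^ 3) continuousAt_const)).mul
    (hpair (fun t => t) (by fun_prop))).mul (hpair (fun _ => c₂) (by fun_prop))).mul
    (hpair (fun _ => d) (by fun_prop))).mul (hpair (fun _ => e) (by fun_prop))).mul
    (hpair (fun _ => f) (by fun_prop))).mul (hpair (fun _ => g) (by fun_prop))
  simp only [psi8Term_eq hq0 hq]
  convert this using 1
  field_simp

theorem summable_psi8Term (hq0 : q ≠ 0) (hq : ‖q‖ < 1) (ha : a ≠ 0)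
    (hz : ‖c₁ * c₂ * d * e * f * g / (q * p ^ 3)‖ < 1) :
    Summable (psi8Term q p a c₁ c₂ d e f g) :=
  (ratioAt_psi8Term hq0 hq ha c₂ d e f g c₁).summable hq hz

/-- The full bilateral series with `X = aq^n`, `n ∈ ℤ`, cut into two unilateral series: the terms
of negative index are those of the series for `p/a` with weight `-(p/a²)²`. -/
noncomputable def psi8Sum (q p a c₁ c₂ d e f g : ℂ) : ℂ :=
  ∑' n, psi8Term q p a c₁ c₂ d e f g n
    - (p / a ^ 2) ^ 2 * ∑' n, psi8Term q p (p / a) c₁ c₂ d e f g n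

theorem psi8Sum_comm (q p a c₁ c₂ d e f g : ℂ) :
    psi8Sum q p a c₁ c₂ d e f g = psi8Sum q p a c₂ c₁ d e f g := by
  unfold psi8Sum
  simp only [psi8Term_comm q p _ c₁ c₂]

/-- For `c₂ = -p/a` all terms of negative index vanish, and for `c₁ = -aq^{N+1}` so do the terms of
index greater than `N`. -/
theorem psi8Sum_terminating (hq : ‖q‖ < 1) (hq0 : q ≠ 0) (hp : p ≠ 0) (ha : a ≠ 0)
    (d e f g : ℂ) (N : ℕ) :
    psi8Sum q p a (-a * q ^ (N + 1)) (-p / a) d e f g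
      = ∑ k ∈ Finset.range (N + 1), psi8Term q p a (-a * q ^ (N + 1)) (-p / a) d e f g k := by
  have h1 : ∀ k ∉ Finset.range (N + 1),
      psi8Term q p a (-a * q ^ (N + 1)) (-p / a) d e f g k = 0 := by
    intro k hk
    rw [Finset.mem_range, not_lt] at hk
    have h : qPochInf q (-(-a * q ^ (N + 1) / (a * q ^ k))) = 0 :=
      qPochInf_eq_zero hq (n := k - (N + 1)) (by
        have := pow_add q (k - (N + 1)) (N + 1)
        rw [Nat.sub_add_cancel hk] at this
        rw [this]
        field_simp)
    simp only [psi8Term, pairInf, h, zero_mul, mul_zero]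
  have h2 : ∀ k, psi8Term q p (p / a) (-a * q ^ (N + 1)) (-p / a) d e f g k = 0 := by
    intro k
    have h : qPochInf q (-(-p / a / (p / a * q ^ k))) = 0 :=
      qPochInf_eq_zero hq (n := k) (by field_simp)
    simp only [psi8Term, pairInf, h, zero_mul, mul_zero]
  rw [psi8Sum, tsum_eq_sum h1, tsum_congr h2, tsum_zero, mul_zero, sub_zero]

theorem psi8Term_mul_base (q p a c₁ c₂ d e f g : ℂ) (n : ℕ) :
    (a ^ 2 / p) ^ 3 * q ^ 5 * psi8Term q p (q * a) c₁ c₂ d e f g n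
      = psi8Term q p a c₁ c₂ d e f g (n + 1) := by
  unfold psi8Term
  rw [show a * q ^ (n + 1) = q * a * q ^ n by ring]
  ring

theorem pairInf_reflect (hq0 : q ≠ 0) (hp : p ≠ 0) (ha : a ≠ 0) (c : ℂ) :
    pairInf q p c (p / (q * a)) = pairInf q p c a := by
  unfold pairInf
  rw [show -(c / (p / (q * a))) = -(c * q * a / p) by field_simp,
    show -(c * q * (p / (q * a)) / p) = -(c / a) by field_simp, mul_comm]

/-- Replacing `a` by `qa` shifts the index of the bilateral series by one. -/
theorem psi8Sum_mul_base (hq0 : q ≠ 0) (hq : ‖q‖ < 1) (hp : p ≠ 0) (ha : a ≠ 0)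
    (hz : ‖c₁ * c₂ * d * e * f * g / (q * p ^ 3)‖ < 1) :
    (a ^ 2 / p) ^ 3 * q ^ 5 * psi8Sum q p (q * a) c₁ c₂ d e f g
      = psi8Sum q p a c₁ c₂ d e f g := by
  have hr : p / (q * a) ≠ 0 := div_ne_zero hp (mul_ne_zero hq0 ha)
  have h1 : ∑' n, psi8Term q p a c₁ c₂ d e f g n = psi8Term q p a c₁ c₂ d e f g 0
      + (a ^ 2 / p) ^ 3 * q ^ 5 * ∑' n, psi8Term q p (q * a) c₁ c₂ d e f g n := by
    rw [(summable_psi8Term hq0 hq ha hz).tsum_eq_zero_add, ← tsum_mul_left]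
    simp only [psi8Term_mul_base]
  have h2 : ∑' n, psi8Term q p (p / (q * a)) c₁ c₂ d e f g n
      = psi8Term q p (p / (q * a)) c₁ c₂ d e f g 0
      + ((p / (q * a)) ^ 2 / p) ^ 3 * q ^ 5 * ∑' n, psi8Term q p (p / a) c₁ c₂ d e f g n := by
    rw [(summable_psi8Term hq0 hq hr hz).tsum_eq_zero_add, ← tsum_mul_left]
    simp only [← psi8Term_mul_base]
    rw [show q * (p / (q * a)) = p / a by field_simp]
  -- The term that moves from one half of the series to the other.
  have h3 : psi8Term q p (p / (q * a)) c₁ c₂ d e f g 0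
      = -(p / (q * a ^ 2)) * psi8Term q p a c₁ c₂ d e f g 0 := by
    unfold psi8Term
    simp only [pow_zero, mul_one, pairInf_reflect hq0 hp ha]
    have : 1 - q * (p / (q * a)) ^ 2 / p = -(p / (q * a ^ 2)) * (1 - q * a ^ 2 / p) := by
      field_simp
      ring
    rw [this]
    ring
  unfold psi8Sum
  rw [h1, h2, h3]
  field_simp
  ring

theorem vwpTheta_mul_base (hq0 : q ≠ 0) (hq : ‖q‖ < 1) (hp : p ≠ 0) (ha : a ≠ 0) :
    (a ^ 2 / p) ^ 2 * q ^ 3 * vwpTheta q p (q * a) = vwpTheta q p a := by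
  have h1 := theta_quasiperiodic hq0 hq (y := q * a ^ 2 / p) (by simp [hq0, hp, ha])
  have h2 := theta_quasiperiodic hq0 hq (y := q * (q * a ^ 2 / p)) (by simp [hq0, hp, ha])
  rw [show q * (q * (q * a ^ 2 / p)) = q * (q * a) ^ 2 / p by ring,
    show q / (q * (q * a) ^ 2 / p) = p / (q * a) ^ 2 by field_simp] at h2
  rw [show q / (q * a ^ 2 / p) = p / a ^ 2 by field_simp] at h1
  unfold vwpTheta
  linear_combination qPochInf q q * (q * a ^ 2 / p) * h2 - qPochInf q q * h1

/-! ### The eight-parameter identity -/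

/-- The identity satisfied by the bilateral series, after clearing denominators. For `p = ab`,
`c₁ = ab` and `c₂ = c` this becomes the relation between `ρ` and `R`. -/
def BilateralIdentity (q p a c₁ c₂ d e f g : ℂ) : Prop :=
  psi8Sum q p a c₁ c₂ d e f g * qPochInf q (q * p / (f * g))
      * qPochInf q (c₁ * c₂ * d * e * f * g / (q * p ^ 3))
    = vwpTheta q p a * (thetaPair q p g a * ∑' m, phi8Term q p c₁ c₂ d e f g m
      + thetaPair q p f a * ∑' m, phi8Term q p c₁ c₂ d e g f m)

/-- Both sides of the identity have the same quasi-periodicity in `a`. -/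
theorem BilateralIdentity.mul_pow (hq0 : q ≠ 0) (hq : ‖q‖ < 1) (hp : p ≠ 0) (ha : a ≠ 0)
    (hf : f ≠ 0) (hg : g ≠ 0) (hz : ‖c₁ * c₂ * d * e * f * g / (q * p ^ 3)‖ < 1)
    (h : BilateralIdentity q p a c₁ c₂ d e f g) (M : ℕ) :
    BilateralIdentity q p (a * q ^ M) c₁ c₂ d e f g := by
  induction M with
  | zero => simpa using h
  | succ M ih =>
    have hX : a * q ^ M ≠ 0 := mul_ne_zero ha (pow_ne_zero M hq0)
    rw [show a * q ^ (M + 1) = q * (a * q ^ M) by ring]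
    generalize a * q ^ M = X at ih hX ⊢
    unfold BilateralIdentity at ih ⊢
    rw [← psi8Sum_mul_base hq0 hq hp hX hz, ← vwpTheta_mul_base hq0 hq hp hX,
      ← thetaPair_step hq0 hq hp hf hX, ← thetaPair_step hq0 hq hp hg hX] at ih
    have hne : (X ^ 2 / p) ^ 3 * q ^ 5 ≠ 0 := by simp [hq0, hp, hX]
    refine mul_left_cancel₀ hne ?_
    linear_combination ih

theorem bilateralIdentity_terminating (hq0 : q ≠ 0) (hq : ‖q‖ < 1) (hp : p ≠ 0) (ha : a ≠ 0)
    (hf : f ≠ 0) (hg : g ≠ 0)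
    (hfg : ∀ n : ℕ, f / g * q ^ n ≠ 1) (hgf : ∀ n : ℕ, g / f * q ^ n ≠ 1)
    (hl : ∀ n : ℕ, d * e * g / (p * f) * q ^ n ≠ 1)
    (hl' : ∀ n : ℕ, d * e * f / (p * g) * q ^ n ≠ 1) (N : ℕ) :
    BilateralIdentity q p a (-a * q ^ (N + 1)) (-p / a) d e f g := by
  unfold BilateralIdentity
  rw [psi8Sum_terminating hq hq0 hp ha,
    show -a * q ^ (N + 1) * (-p / a) * d * e * f * g / (q * p ^ 3)
      = d * e * f * g / p ^ 2 * q ^ N by field_simp; ring]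
  exact sum_psi8Term_eq hq0 hq hp ha hf hg hfg hgf hl hl' N

theorem BilateralIdentity.comm (h : BilateralIdentity q p a c₁ c₂ d e f g) :
    BilateralIdentity q p a c₂ c₁ d e f g := by
  unfold BilateralIdentity at h ⊢
  rw [psi8Sum_comm, mul_comm c₂ c₁]
  simp only [phi8Term_comm q p c₂ c₁]
  exact h

theorem differentiable_psi8Term (hq : ‖q‖ < 1) (p a c₂ d e f g : ℂ) (n : ℕ) :
    Differentiable ℂ fun c₁ => psi8Term q p a c₁ c₂ d e f g n := by
  have h := differentiable_pairInf hq p (a * q ^ n)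
  unfold psi8Term
  fun_prop

theorem differentiable_phi8Term (hq : ‖q‖ < 1) (p c₂ d e f g : ℂ) (n : ℕ) :
    Differentiable ℂ fun c₁ => phi8Term q p c₁ c₂ d e f g n := by
  have h1 : Differentiable ℂ (fun x => qDesc q x n) := differentiable_qDesc q n
  have h2 := differentiable_qPochInf hq
  have h3 : Differentiable ℂ fun c₁ => qDesc q (c₁ * f / p) n := h1.comp (by fun_prop)
  have h4 : Differentiable ℂ fun c₁ => qPochInf q (c₁ * (d * e * g) / p ^ 2 * q ^ n) :=
    h2.comp (by fun_prop)
  have h5 : Differentiable ℂ fun c₁ => qPochInf q (c₁ * c₂ / p) := h2.comp (by fun_prop)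
  have h6 : Differentiable ℂ fun c₁ => qPochInf q (c₁ * f / p) := h2.comp (by fun_prop)
  unfold phi8Term
  fun_prop

theorem isOpen_setOf_norm_mul_lt (α β : ℂ) : IsOpen {c : ℂ | ‖c * α‖ < 1 ∧ ‖c * β‖ < 1} := by
  have h : ∀ γ : ℂ, IsOpen {c : ℂ | ‖c * γ‖ < 1} := fun γ =>
    isOpen_lt (by fun_prop) continuous_const
  exact (h α).and (h β)

theorem convex_setOf_norm_mul_lt (α β : ℂ) :
    Convex ℝ {c : ℂ | ‖c * α‖ < 1 ∧ ‖c * β‖ < 1} := by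
  have h : ∀ γ x y : ℂ, ‖x * γ‖ < 1 → ‖y * γ‖ < 1 → ∀ s t : ℝ, 0 ≤ s → 0 ≤ t → s + t = 1 →
      ‖(s • x + t • y) * γ‖ < 1 := by
    intro γ x y hx hy s t hs ht hst
    have := convex_ball (0 : ℂ) 1 (mem_ball_zero_iff.2 hx) (mem_ball_zero_iff.2 hy) hs ht hst
    rw [mem_ball_zero_iff] at this
    rwa [add_mul, smul_mul_assoc, smul_mul_assoc]
  exact fun x hx y hy s t hs ht hst =>
    ⟨h α x y hx.1 hy.1 s t hs ht hst, h β x y hx.2 hy.2 s t hs ht hst⟩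

/-- A holomorphic function on a disc-like domain that vanishes along a sequence converging to the
centre `0` vanishes identically. -/
theorem eq_zero_of_vanishing_seq {F : ℂ → ℂ} {α β : ℂ}
    (hF : DifferentiableOn ℂ F {c | ‖c * α‖ < 1 ∧ ‖c * β‖ < 1}) {w : ℕ → ℂ}
    (hw : Tendsto w atTop (𝓝 0)) (hw0 : ∀ n, w n ≠ 0) (hFw : ∀ᶠ n in atTop, F (w n) = 0)
    {c : ℂ} (hα : ‖c * α‖ < 1) (hβ : ‖c * β‖ < 1) : F c = 0 := by
  have hopen := isOpen_setOf_norm_mul_lt α β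
  have hfreq : ∃ᶠ z in 𝓝[≠] (0 : ℂ), F z = 0 :=
    (tendsto_nhdsWithin_iff.2 ⟨hw, .of_forall hw0⟩).frequently hFw.frequently
  exact (hF.analyticOnNhd hopen).eqOn_zero_of_preconnected_of_frequently_eq_zero
    (convex_setOf_norm_mul_lt α β).isPreconnected (by simp) hfreq ⟨hα, hβ⟩

/-- Analytic continuation of the identity in the parameter `c₁`. -/
theorem BilateralIdentity.of_seq (hq0 : q ≠ 0) (hq : ‖q‖ < 1) (hp : p ≠ 0) (ha : a ≠ 0)
    (hf : f ≠ 0) (hg : g ≠ 0) {w : ℕ → ℂ} (hw : Tendsto w atTop (𝓝 0)) (hw0 : ∀ n, w n ≠ 0)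
    (h : ∀ᶠ n in atTop, BilateralIdentity q p a (w n) c₂ d e f g) (hc : ‖c₁ * c₂ / p‖ < 1)
    (hz : ‖c₁ * c₂ * d * e * f * g / (q * p ^ 3)‖ < 1) :
    BilateralIdentity q p a c₁ c₂ d e f g := by
  set α := c₂ / p with hα
  set β := c₂ * d * e * f * g / (q * p ^ 3) with hβ
  have eα : ∀ c, c * c₂ / p = c * α := fun c => by rw [hα]; ring
  have eβ : ∀ c, c * c₂ * d * e * f * g / (q * p ^ 3) = c * β := fun c => by rw [hβ]; ring
  have hopen := isOpen_setOf_norm_mul_lt α β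
  have hpsi : ∀ x : ℂ, x ≠ 0 → DifferentiableOn ℂ (fun c => ∑' n, psi8Term q p x c c₂ d e f g n)
      {c | ‖c * α‖ < 1 ∧ ‖c * β‖ < 1} := fun x hx =>
    RatioAt.differentiableOn_tsum hq hopen
      (fun c _ => ratioAt_psi8Term hq0 hq hx c₂ d e f g c) (fun c hc => by rw [eβ]; exact hc.2)
      fun n => (differentiable_psi8Term hq p x c₂ d e f g n).differentiableOn
  have hphi : ∀ x y : ℂ, x ≠ 0 → DifferentiableOn ℂ (fun c => ∑' n, phi8Term q p c c₂ d e x y n)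
      {c | ‖c * α‖ < 1 ∧ ‖c * β‖ < 1} := fun x y hx =>
    RatioAt.differentiableOn_tsum hq hopen
      (fun c _ => (ratioAt_phi8Term hq hx hp e y (c, c₂, d)).comp (φ := fun c : ℂ => (c, c₂, d))
        (by fun_prop)) (fun c hc => by rw [eα]; exact hc.1)
      fun n => (differentiable_phi8Term hq p c₂ d e x y n).differentiableOn
  have h1 := hpsi a ha
  have h2 := hpsi (p / a) (div_ne_zero hp ha)
  have h3 := hphi f g hf
  have h4 := hphi g f hg
  have h5 := differentiable_qPochInf hq
  have h6 : Differentiable ℂ fun c => qPochInf q (c * c₂ * d * e * f * g / (q * p ^ 3)) :=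
    h5.comp (by fun_prop)
  have := eq_zero_of_vanishing_seq (F := fun c => psi8Sum q p a c c₂ d e f g
      * qPochInf q (q * p / (f * g)) * qPochInf q (c * c₂ * d * e * f * g / (q * p ^ 3))
    - vwpTheta q p a * (thetaPair q p g a * ∑' m, phi8Term q p c c₂ d e f g m
      + thetaPair q p f a * ∑' m, phi8Term q p c c₂ d e g f m)) (α := α) (β := β) (c := c₁)
    ((((h1.sub (h2.const_mul _)).mul_const _).mul h6.differentiableOn).sub
      (((h3.const_mul _).add (h4.const_mul _)).const_mul _)) hw hw0
    (h.mono fun n hn => sub_eq_zero.2 hn) (by rwa [← eα]) (by rwa [← eβ])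
  exact sub_eq_zero.1 this

/-- The eight-parameter identity in general: it is continued from `c₁ = -aq^{N+1-M}`,
`c₂ = -(p/a)q^M`, first in `c₁` for fixed `M` and then in `c₂`. -/
theorem bilateralIdentity (hq0 : q ≠ 0) (hq : ‖q‖ < 1) (hp : p ≠ 0) (ha : a ≠ 0)
    (hf : f ≠ 0) (hg : g ≠ 0)
    (hfg : ∀ n : ℕ, f / g * q ^ n ≠ 1) (hgf : ∀ n : ℕ, g / f * q ^ n ≠ 1)
    (hl : ∀ n : ℕ, d * e * g / (p * f) * q ^ n ≠ 1)
    (hl' : ∀ n : ℕ, d * e * f / (p * g) * q ^ n ≠ 1) (hc : ‖c₁ * c₂ / p‖ < 1)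
    (hz : ‖c₁ * c₂ * d * e * f * g / (q * p ^ 3)‖ < 1) :
    BilateralIdentity q p a c₁ c₂ d e f g := by
  -- The special values `c₂ = -(p/a)q^M` with `M ≥ 0`.
  have key : ∀ M : ℕ, ∀ c : ℂ, ‖c * (-p / a * q ^ M) / p‖ < 1 →
      ‖c * (-p / a * q ^ M) * d * e * f * g / (q * p ^ 3)‖ < 1 →
      BilateralIdentity q p a c (-p / a * q ^ M) d e f g := by
    intro M c hc hz
    have hM : q ^ M ≠ 0 := pow_ne_zero M hq0
    have ha' : a / q ^ M ≠ 0 := div_ne_zero ha hM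
    have hw : Tendsto (fun N => -(a / q ^ M) * q ^ (N + 1)) atTop (𝓝 0) :=
      (tendsto_const_mul_pow_zero hq _).comp (tendsto_add_atTop_nat 1)
    refine BilateralIdentity.of_seq hq0 hq hp ha hf hg hw (fun N => by simp [ha, hq0]) ?_ hc hz
    have hz' : ∀ᶠ N in atTop, ‖-(a / q ^ M) * q ^ (N + 1) * (-p / a * q ^ M) * d * e * f * g
        / (q * p ^ 3)‖ < 1 := by
      have : Tendsto (fun N => ‖-(a / q ^ M) * q ^ (N + 1) * (-p / a * q ^ M) * d * e * f * g
        / (q * p ^ 3)‖) atTop (𝓝 ‖(0 : ℂ) * (-p / a * q ^ M) * d * e * f * g / (q * p ^ 3)‖) :=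
        ((((((hw.mul_const _).mul_const _).mul_const _).mul_const _).mul_const _).div_const _).norm
      exact this.eventually_lt_const (by simp)
    filter_upwards [hz'] with N hN
    have h := bilateralIdentity_terminating hq0 hq hp ha' hf hg hfg hgf hl hl' N
    rw [show -p / (a / q ^ M) = -p / a * q ^ M by field_simp] at h
    have h' := h.mul_pow hq0 hq hp ha' hf hg hN M
    rwa [div_mul_cancel₀ a hM] at h'
  refine (BilateralIdentity.of_seq (c₂ := c₁) (c₁ := c₂) hq0 hq hp ha hf hg
    (tendsto_const_mul_pow_zero hq (-p / a)) (fun M => by simp [hp, ha, hq0]) ?_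
    (by rwa [mul_comm]) (by rwa [mul_comm c₂])).comm
  have t1 : Tendsto (fun M => ‖c₁ * (-p / a * q ^ M) / p‖) atTop (𝓝 ‖c₁ * 0 / p‖) :=
    (((tendsto_const_mul_pow_zero hq (-p / a)).const_mul c₁).div_const p).norm
  have t2 : Tendsto (fun M => ‖c₁ * (-p / a * q ^ M) * d * e * f * g / (q * p ^ 3)‖) atTop
      (𝓝 ‖c₁ * 0 * d * e * f * g / (q * p ^ 3)‖) :=
    ((((((tendsto_const_mul_pow_zero hq (-p / a)).const_mul c₁).mul_const d).mul_const e).mul_const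
      f).mul_const g).div_const _ |>.norm
  filter_upwards [t1.eventually_lt_const (u := 1) (by simp),
    t2.eventually_lt_const (u := 1) (by simp)] with M h1 h2
  exact (key M c₁ h1 h2).comm

end Bilateral

/-! ### The series `ρ` in terms of the bilateral series -/

section Rho

variable {q a b c d e f g : ℂ}

theorem qPoch_div_qPoch_mul (hq0 : q ≠ 0) (hq : ‖q‖ < 1) (ha : a ≠ 0) (hc : c ≠ 0)
    (h : ∀ n : ℕ, -c / b * q ^ n ≠ 1) (k : ℕ) :
    qPoch q (-(q * a) / c) k / qPoch q (-c / b) (k + 1)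
        * (qPochInf q (-c / a) * qPochInf q (-c / b)) * (c / a) ^ k
      = q ^ ((k + 1).choose 2) * pairInf q (a * b) c (a * q ^ k) := by
  have h1 := qPochInf_eq_qPoch_mul hq (-c / b) (k + 1)
  have h2 := qDesc_eq_qPoch (q := q) (x := -(c / a)) (by simp [hc, ha]) k
  have h3 : qPoch q (-c / b) (k + 1) ≠ 0 := qPoch_ne_zero h _
  rw [neg_neg, show q / -(c / a) = -(q * a) / c by field_simp] at h2
  rw [pairInf_mul_pow hq0 hq, h2, h1,
    show -(c * q * a / (a * b)) * q ^ k = -c / b * q ^ (k + 1) by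
      rw [show c * q * a / (a * b) = c * q / b by field_simp]; ring, ← neg_div a c]
  rw [div_mul_eq_mul_div, div_mul_eq_mul_div, div_eq_iff h3]
  ring

theorem qDesc_neg_mul (hb : b ≠ 0) (k : ℕ) :
    qDesc q (-b) k * (1 + b) = b ^ (k + 1) * qPoch q (-1 / b) (k + 1) := by
  induction k with
  | zero =>
    rw [qDesc_zero, zero_add, qPoch_one]
    field_simp
    ring
  | succ k ih =>
    have h : q ^ (k + 1) - -b = b * (1 - -1 / b * q ^ (k + 1)) := by
      field_simp
      ring
    rw [qDesc_succ, qPoch_succ, h]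
    linear_combination b * (1 - -1 / b * q ^ (k + 1)) * ih

theorem qPoch_div_qPoch_mul_self (hq0 : q ≠ 0) (hq : ‖q‖ < 1) (ha : a ≠ 0) (hb : b ≠ 0)
    (h : ∀ n : ℕ, -(q * a) * q ^ n ≠ 1) (k : ℕ) :
    qPoch q (-1 / b) (k + 1) / qPoch q (-(q * a)) k
        * (qPochInf q (-(q * a)) * qPochInf q (-(q * b))) * b ^ (k + 1)
      = q ^ ((k + 1).choose 2) * pairInf q (a * b) (a * b) (a * q ^ k) := by
  have h1 := qPochInf_eq_qPoch_mul hq (-(q * a)) k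
  have h2 := qDesc_neg_mul (q := q) hb k
  have h3 : qPoch q (-(q * a)) k ≠ 0 := qPoch_ne_zero h _
  have h4 : qPochInf q (-b) = (1 - -b) * qPochInf q (-(q * b)) :=
    qPochInf_step_of_eq hq (by ring)
  rw [pairInf_mul_pow hq0 hq, h1, show -(a * b / a) = -b by field_simp, h4,
    show -(a * b * q * a / (a * b)) = -(q * a) by field_simp]
  calc _ = b ^ (k + 1) * qPoch q (-1 / b) (k + 1)
        * (qPochInf q (-(q * a) * q ^ k) * qPochInf q (-(q * b))) := by
        rw [div_mul_eq_mul_div, div_mul_eq_mul_div, div_eq_iff h3]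
        ring
    _ = _ := by
        rw [← h2]
        ring

/-- The product of all the infinite `q`-shifted factorials in the denominators of `ρ(a,b;…)` and
`ρ(b,a;…)`. -/
noncomputable def rhoFactor (q a b c d e f g : ℂ) : ℂ :=
  qPochInf q (-(q * a)) * qPochInf q (-(q * b)) * (qPochInf q (-c / a) * qPochInf q (-c / b))
    * (qPochInf q (-d / a) * qPochInf q (-d / b)) * (qPochInf q (-e / a) * qPochInf q (-e / b))
    * (qPochInf q (-f / a) * qPochInf q (-f / b)) * (qPochInf q (-g / a) * qPochInf q (-g / b))

/-- The series `ρ(a,b; …)` is, termwise, the half with `X = aq^k`, `k ≥ 0`, of the bilateral series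
with `p = c₁ = ab` and `c₂ = c`. -/
theorem rhoTerm_mul_rhoFactor (hq0 : q ≠ 0) (hq : ‖q‖ < 1) (ha : a ≠ 0) (hb : b ≠ 0)
    (hc : c ≠ 0) (hd : d ≠ 0) (he : e ≠ 0) (hf : f ≠ 0) (hg : g ≠ 0)
    (h : ∀ x ∈ [-(q * a), -c / b, -d / b, -e / b, -f / b, -g / b], ∀ n : ℕ, x * q ^ n ≠ 1)
    (k : ℕ) :
    b * rhoTerm q a b c d e f g k * rhoFactor q a b c d e f g
      = psi8Term q (a * b) a (a * b) c d e f g k := by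
  simp only [List.forall_mem_cons] at h
  obtain ⟨n0, n1, n2, n3, n4, n5, -⟩ := h
  have h0 := qPoch_div_qPoch_mul_self hq0 hq ha hb n0 k
  have h1 := qPoch_div_qPoch_mul hq0 hq ha hc n1 k
  have h2 := qPoch_div_qPoch_mul hq0 hq ha hd n2 k
  have h3 := qPoch_div_qPoch_mul hq0 hq ha he n3 k
  have h4 := qPoch_div_qPoch_mul hq0 hq ha hf n4 k
  have h5 := qPoch_div_qPoch_mul hq0 hq ha hg n5 k
  have hw : (a ^ 2 / (a * b)) ^ (3 * k) * q ^ (3 * k ^ 2 + 2 * k)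
      * (b ^ k * (c / a) ^ k * (d / a) ^ k * (e / a) ^ k * (f / a) ^ k * (g / a) ^ k)
      = (c * d * e * f * g / (q * a ^ 2 * b ^ 2)) ^ k * (q ^ ((k + 1).choose 2)) ^ 6 := by
    have e1 : (q ^ ((k + 1).choose 2)) ^ 6 = q ^ (3 * k ^ 2 + 2 * k) * q ^ k := by
      rw [show (q ^ ((k + 1).choose 2)) ^ 6
        = (q ^ ((k + 1).choose 2) * q ^ ((k + 1).choose 2)) ^ 3 by ring, ← pow_add,
        two_mul_choose_succ_two]
      ring
    have e2 : ((a ^ 2 / (a * b)) ^ 3) ^ k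
        * (b ^ k * (c / a) ^ k * (d / a) ^ k * (e / a) ^ k * (f / a) ^ k * (g / a) ^ k)
        = (c * d * e * f * g / (q * a ^ 2 * b ^ 2)) ^ k * q ^ k := by
      simp only [← mul_pow]
      congr 1
      field_simp
    rw [e1, pow_mul]
    linear_combination q ^ (3 * k ^ 2 + 2 * k) * e2
  have hne : b ^ k * (c / a) ^ k * (d / a) ^ k * (e / a) ^ k * (f / a) ^ k * (g / a) ^ k ≠ 0 := by
    simp [ha, hb, hc, hd, he, hf, hg]
  refine mul_right_cancel₀ hne ?_
  have hu : q * (a * q ^ k) ^ 2 / (a * b) = a * q ^ (2 * k + 1) / b := by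
    field_simp
    ring
  unfold psi8Term
  rw [hu]
  calc _ = (1 - a * q ^ (2 * k + 1) / b) * (c * d * e * f * g / (q * a ^ 2 * b ^ 2)) ^ k
      * (qPoch q (-1 / b) (k + 1) / qPoch q (-(q * a)) k
        * (qPochInf q (-(q * a)) * qPochInf q (-(q * b))) * b ^ (k + 1))
      * (qPoch q (-(q * a) / c) k / qPoch q (-c / b) (k + 1)
        * (qPochInf q (-c / a) * qPochInf q (-c / b)) * (c / a) ^ k)
      * (qPoch q (-(q * a) / d) k / qPoch q (-d / b) (k + 1)
        * (qPochInf q (-d / a) * qPochInf q (-d / b)) * (d / a) ^ k)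
      * (qPoch q (-(q * a) / e) k / qPoch q (-e / b) (k + 1)
        * (qPochInf q (-e / a) * qPochInf q (-e / b)) * (e / a) ^ k)
      * (qPoch q (-(q * a) / f) k / qPoch q (-f / b) (k + 1)
        * (qPochInf q (-f / a) * qPochInf q (-f / b)) * (f / a) ^ k)
      * (qPoch q (-(q * a) / g) k / qPoch q (-g / b) (k + 1)
        * (qPochInf q (-g / a) * qPochInf q (-g / b)) * (g / a) ^ k) := by
        simp only [rhoTerm, rhoFactor, qPochs, List.map_cons, List.map_nil, List.prod_cons,
          List.prod_nil, mul_one, mul_div_mul_comm]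
        ring
    _ = _ := by
      rw [h0, h1, h2, h3, h4, h5]
      linear_combination -((1 - a * q ^ (2 * k + 1) / b) * (pairInf q (a * b) (a * b) (a * q ^ k)
        * pairInf q (a * b) c (a * q ^ k) * pairInf q (a * b) d (a * q ^ k)
        * pairInf q (a * b) e (a * q ^ k) * pairInf q (a * b) f (a * q ^ k)
        * pairInf q (a * b) g (a * q ^ k))) * hw

end Rho

/-! ### The function `R` in terms of the very-well-poised `₈φ₇` series -/

section RFunction

variable {q a b c d e f g : ℂ}

theorem csqrt_sq (z : ℂ) : csqrt z ^ 2 = z := by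
  have := Complex.cpow_nat_inv_pow z (n := 2) two_ne_zero
  rwa [csqrt, one_div]

theorem qPoch_mul_base (q s : ℂ) (m : ℕ) :
    qPoch q (q * s) m * (1 - s) = qPoch q s m * (1 - s * q ^ m) := by
  rw [← qPoch_succ, qPoch_succ', mul_comm s q, mul_comm]

theorem phiTerm_RNum_RDen (q a b c d e f g : ℂ) (m : ℕ) :
    phiTerm q c (RNum q a b c d e f g) (RDen q a b c d e f g) m
      = qPochs q (RNum q a b c d e f g) m / (qPoch q q m * qPochs q (RDen q a b c d e f g) m)
        * c ^ m := by
  have h : ((RDen q a b c d e f g).length : ℤ) + 1 - ((RNum q a b c d e f g).length : ℤ) = 0 := by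
    simp [RNum, RDen]
  rw [phiTerm, h, zpow_zero, mul_one]

theorem summable_phiTerm (hq : ‖q‖ < 1) (hc : ‖c‖ < 1) (a b d e f g : ℂ) :
    Summable (phiTerm q c (RNum q a b c d e f g) (RDen q a b c d e f g)) := by
  have hP : ∀ x : ℂ, RatioAt q (fun n (_ : Unit) => qPoch q x n) () 1 := fun x =>
    RatioAt.of_qPoch (w := fun _ : Unit => x) continuousAt_const
  have hPs : ∀ xs : List ℂ, RatioAt q (fun n (_ : Unit) => qPochs q xs n) () 1 := by
    intro xs
    induction xs with
    | nil => simpa [qPochs] using RatioAt.of_const (q := q) (t₀ := ()) fun _ : Unit => (1 : ℂ)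
    | cons x xs ih => simpa [qPochs] using (hP x).mul ih
  have := (((hPs (RNum q a b c d e f g)).div ((hP q).mul (hPs (RDen q a b c d e f g)))
    (by simp)).mul (RatioAt.of_pow (w := fun _ : Unit => c) continuousAt_const)).summable hq
      (by simpa using hc)
  exact this.congr fun m => (phiTerm_RNum_RDen q a b c d e f g m).symm

/-- The field identity behind `phi8Term_eq_mul_phiTerm`, with every `q`-shifted factorial replaced
by a variable. -/
theorem vwp_rearrangement {N₁ N₂ u s₁ s₂ w p₁ p₂ p₃ D₁ D₂ y₁ y₂ y₃ y₄ K₁ K₂ K₃ K₄ K₅ v Q F G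
    v₀ v₁ v₂ v₃ v₄ A B C : ℂ}
    (h₀ : v₀ ≠ 0) (h₁ : v₁ ≠ 0) (h₂ : v₂ ≠ 0) (h₃ : v₃ ≠ 0) (h₄ : v₄ ≠ 0)
    (hD : D₁ * D₂ * w = C * (A * B)) :
    N₁ * N₂ * u / (s₁ * s₂) * w * p₁ * p₂ * p₃ * D₁ * D₂ * y₁ * y₂ * y₃ * y₄
        * (K₁ * K₂ * K₃ * K₄ * K₅) / (v * Q * (F * G))
      = K₁ * K₂ * (v₁ * y₂) * (v₂ * y₁) * K₃ * K₄ * K₅ * (v₃ * y₃) * (v₄ * y₄)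
          / (F * (v₀ * v / u))
        * (v₀ * (N₁ * (N₂ * (p₁ * (p₂ * (p₃ * (A * B))))))
          / (Q * (s₁ * (s₂ * (G * (v₂ * (v₁ * (v₃ * v₄))))))) * C) := by
  calc _ = N₁ * N₂ * u / (s₁ * s₂) * p₁ * p₂ * p₃ * y₁ * y₂ * y₃ * y₄
        * (K₁ * K₂ * K₃ * K₄ * K₅) / (v * Q * (F * G)) * (D₁ * D₂ * w) := by ring
    _ = N₁ * N₂ * u / (s₁ * s₂) * p₁ * p₂ * p₃ * y₁ * y₂ * y₃ * y₄
        * (K₁ * K₂ * K₃ * K₄ * K₅) / (v * Q * (F * G)) * (C * (A * B))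
        * (v₀ / v₀) * (v₁ / v₁) * (v₂ / v₂) * (v₃ / v₃) * (v₄ / v₄) := by
      rw [hD, div_self h₀, div_self h₁, div_self h₂, div_self h₃, div_self h₄]
      ring
    _ = _ := by
      simp only [div_eq_mul_inv, mul_inv, inv_inv]
      ring

/-- With `s = √λ`, the numerator factors `qs, -qs` and denominator factors `s, -s` combine to
`(1 - λq^{2m})/(1 - λ)`; the remaining factors match one by one. -/
theorem phi8Term_eq_mul_phiTerm (hq : ‖q‖ < 1) (ha : a ≠ 0) (hb : b ≠ 0) (hc : c ≠ 0)
    (hf : f ≠ 0)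
    (h : ∀ x ∈ [d * e * g / (a * b * f), q * d / f, q * e / f, d * e * g / (a * b),
      c * d * e * g / (a ^ 2 * b ^ 2)], ∀ n : ℕ, x * q ^ n ≠ 1) (m : ℕ) :
    phi8Term q (a * b) (a * b) c d e f g m
      = qPochInf q c * qPochInf q f * qPochInf q (q * d / f) * qPochInf q (q * e / f)
        * qPochInf q (c * f / (a * b)) * qPochInf q (d * f / (a * b))
        * qPochInf q (e * f / (a * b)) * qPochInf q (d * e * g / (a * b))
        * qPochInf q (c * d * e * g / (a ^ 2 * b ^ 2))
        / (qPochInf q (f / g) * qPochInf q (q * d * e * g / (a * b * f)))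
        * phiTerm q c (RNum q a b c d e f g) (RDen q a b c d e f g) m := by
  simp only [List.forall_mem_cons] at h
  obtain ⟨n0, n1, n2, n3, n4, -⟩ := h
  set s := csqrt (d * e * g / (a * b * f)) with hs
  have hss : s ^ 2 = d * e * g / (a * b * f) := csqrt_sq _
  have hs1 : ∀ n : ℕ, s * q ^ n ≠ 1 := fun n hn => n0 (2 * n) (by
    rw [← hss, show s ^ 2 * q ^ (2 * n) = (s * q ^ n) ^ 2 by ring, hn, one_pow])
  have hs2 : ∀ n : ℕ, -s * q ^ n ≠ 1 := fun n hn => n0 (2 * n) (by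
    rw [← hss, show s ^ 2 * q ^ (2 * n) = (-s * q ^ n) ^ 2 by ring, hn, one_pow])
  have hv : qPoch q (q * s) m * qPoch q (-(q * s)) m * (1 - d * e * g / (a * b * f))
      = qPoch q s m * qPoch q (-s) m * (1 - d * e * g / (a * b * f) * q ^ (2 * m)) := by
    have h1 := qPoch_mul_base q s m
    have h2 := qPoch_mul_base q (-s) m
    rw [mul_neg] at h2
    rw [← hss]
    linear_combination qPoch q (-(q * s)) m * (1 - -s) * h1 + qPoch q s m * (1 - s * q ^ m) * h2
  have i0 := qPochInf_eq_qPoch_mul hq (d * e * g / (a * b * f)) m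
  have i0' : qPochInf q (d * e * g / (a * b * f))
      = (1 - d * e * g / (a * b * f)) * qPochInf q (q * d * e * g / (a * b * f)) :=
    qPochInf_step_of_eq hq (by ring)
  have i1 := qPochInf_eq_qPoch_mul hq (q * d / f) m
  have i2 := qPochInf_eq_qPoch_mul hq (q * e / f) m
  have i3 := qPochInf_eq_qPoch_mul hq (d * e * g / (a * b)) m
  have i4 := qPochInf_eq_qPoch_mul hq (c * d * e * g / (a ^ 2 * b ^ 2)) m
  have k0 := qPochInf_ne_zero hq n0
  have j0 := qPoch_ne_zero n0 m
  have j1 := qPoch_ne_zero n1 m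
  have j2 := qPoch_ne_zero n2 m
  have j3 := qPoch_ne_zero n3 m
  have j4 := qPoch_ne_zero n4 m
  have j5 := qPoch_ne_zero hs1 m
  have j6 := qPoch_ne_zero hs2 m
  have hD : qDesc q f m * qDesc q (c * f / (a * b)) m * (a * b / f ^ 2) ^ m
      = c ^ m * (qPoch q (q / f) m * qPoch q (q * a * b / (c * f)) m) := by
    rw [qDesc_eq_qPoch hf, qDesc_eq_qPoch (by simp [hc, hf, ha, hb]),
      show q / (c * f / (a * b)) = q * a * b / (c * f) by field_simp,
      show c ^ m = (-f) ^ m * (-(c * f / (a * b))) ^ m * (a * b / f ^ 2) ^ m by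
        rw [← mul_pow, ← mul_pow]; congr 1; field_simp]
    ring
  rw [phiTerm_RNum_RDen]
  unfold phi8Term
  simp only [RNum, RDen, qPochs, List.map_cons, List.map_nil, List.prod_cons, List.prod_nil,
    mul_one, ← hs]
  rw [show a * b * f / (a * b) = f by field_simp, show a * b * c / (a * b) = c by field_simp,
    show a * b * (d * e * g) / (a * b) ^ 2 = d * e * g / (a * b) by field_simp,
    show c * (d * e * g) / (a * b) ^ 2 = c * d * e * g / (a ^ 2 * b ^ 2) by ring, i1, i2, i3, i4]
  rw [i0'] at k0
  have k1 := left_ne_zero_of_mul k0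
  have i5 : qPochInf q (q * d * e * g / (a * b * f)) = qPoch q (d * e * g / (a * b * f)) m
      * qPochInf q (d * e * g / (a * b * f) * q ^ m) / (1 - d * e * g / (a * b * f)) := by
    rw [eq_div_iff k1, ← i0, i0']
    ring
  have hv' : 1 - d * e * g / (a * b * f) * q ^ (2 * m) = qPoch q (q * s) m * qPoch q (-(q * s)) m
      * (1 - d * e * g / (a * b * f)) / (qPoch q s m * qPoch q (-s) m) := by
    rw [eq_div_iff (mul_ne_zero j5 j6), hv]
    ring
  rw [i5, hv']
  exact vwp_rearrangement j0 j1 j2 j3 j4 hD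

/-- The theta functions in `R(a,b,c,d,e;f,g)` are those of the bilateral identity. -/
theorem thetaPair_eq (hq : ‖q‖ < 1) (ha : a ≠ 0) (hb : b ≠ 0) (hg : g ≠ 0) :
    thetaPair q (a * b) g a = b / g * (qPochInf q (-g / a) * qPochInf q (-g / b)
      * qPochInf q (-(q * a) / g) * qPochInf q (-(q * b) / g)) := by
  have h1 : qPochInf q (-(b / g)) = (1 - -(b / g)) * qPochInf q (-(q * b) / g) :=
    qPochInf_step_of_eq hq (by ring)
  have h2 : qPochInf q (-g / b) = (1 - -g / b) * qPochInf q (-(g * q / b)) :=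
    qPochInf_step_of_eq hq (by ring)
  unfold thetaPair pairInf
  rw [show a * b / (g * a) = b / g by field_simp,
    show g * q * a / (a * b) = g * q / b by field_simp,
    h1, h2, ← neg_div, ← neg_div g (q * a)]
  field_simp
  ring

theorem vwpTheta_eq (hq : ‖q‖ < 1) (ha : a ≠ 0) :
    vwpTheta q (a * b) a
      = (1 - b / a) * (qPochInf q q * qPochInf q (q * a / b) * qPochInf q (q * b / a)) := by
  have h1 : qPochInf q (b / a) = (1 - b / a) * qPochInf q (q * b / a) :=
    qPochInf_step_of_eq hq (by ring)
  unfold vwpTheta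
  rw [show q * a ^ 2 / (a * b) = q * a / b by field_simp,
    show a * b / a ^ 2 = b / a by field_simp, h1]
  ring

/-- After clearing denominators, `R(a,b,c,d,e;f,g)` is one of the two terms on the right side of the
bilateral identity, up to the factor `1/b²`. -/
theorem R_mul_rhoFactor (hq : ‖q‖ < 1) (ha : a ≠ 0) (hb : b ≠ 0) (hc : c ≠ 0) (hf : f ≠ 0)
    (hg : g ≠ 0)
    (h : ∀ x ∈ [d * e * g / (a * b * f), q * d / f, q * e / f, d * e * g / (a * b),
      c * d * e * g / (a ^ 2 * b ^ 2)], ∀ n : ℕ, x * q ^ n ≠ 1)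
    (hF : rhoFactor q a b c d e f g ≠ 0) (h1 : qPochInf q (q * a * b / (f * g)) ≠ 0)
    (h2 : qPochInf q (c * d * e * f * g / (q * a ^ 2 * b ^ 2)) ≠ 0) :
    R q a b c d e f g * (rhoFactor q a b c d e f g * qPochInf q (q * a * b / (f * g))
        * qPochInf q (c * d * e * f * g / (q * a ^ 2 * b ^ 2)))
      = 1 / b ^ 2 * vwpTheta q (a * b) a * (thetaPair q (a * b) g a
        * ∑' m, phi8Term q (a * b) (a * b) c d e f g m) := by
  simp only [phi8Term_eq_mul_phiTerm hq ha hb hc hf h, tsum_mul_left]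
  rw [thetaPair_eq hq ha hb hg, vwpTheta_eq hq ha]
  unfold rhoFactor at hF ⊢
  simp only [mul_ne_zero_iff] at hF
  obtain ⟨⟨⟨⟨⟨⟨n1, n2⟩, n3, n4⟩, n5, n6⟩, n7, n8⟩, n9, n10⟩, n11, n12⟩ := hF
  have hS : 1 / b ^ 2 * (1 - b / a) * (b / g) = 1 / g * (1 / b - 1 / a) := by
    field_simp
  have key : ∀ F L : ℂ, qPochInf q (-(q * a)) * qPochInf q (-(q * b))
        * (qPochInf q (-c / a) * qPochInf q (-c / b)) * (qPochInf q (-d / a) * qPochInf q (-d / b))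
        * (qPochInf q (-e / a) * qPochInf q (-e / b)) * (qPochInf q (-f / a) * qPochInf q (-f / b))
        * (qPochInf q (-g / a) * qPochInf q (-g / b)) * qPochInf q (q * a * b / (f * g))
        * qPochInf q (c * d * e * f * g / (q * a ^ 2 * b ^ 2))
        / ((qPochInf q (-(q * a)) * (qPochInf q (-(q * b)) * (qPochInf q (-c / a)
          * (qPochInf q (-c / b) * qPochInf q (-d / a)))))
          * (qPochInf q (-d / b) * (qPochInf q (-e / a) * (qPochInf q (-e / b)
          * (qPochInf q (-f / a) * (qPochInf q (-f / b) * (F * (qPochInf q (q * a * b / (f * g))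
          * (L * qPochInf q (c * d * e * f * g / (q * a ^ 2 * b ^ 2)))))))))))
      = qPochInf q (-g / a) * qPochInf q (-g / b) / (F * L) := by
    intro F L
    generalize qPochInf q (-(q * a)) = x1 at *
    generalize qPochInf q (-(q * b)) = x2 at *
    generalize qPochInf q (-c / a) = x3 at *
    generalize qPochInf q (-c / b) = x4 at *
    generalize qPochInf q (-d / a) = x5 at *
    generalize qPochInf q (-d / b) = x6 at *
    generalize qPochInf q (-e / a) = x7 at *
    generalize qPochInf q (-e / b) = x8 at *
    generalize qPochInf q (-f / a) = x9 at *
    generalize qPochInf q (-f / b) = x10 at *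
    generalize qPochInf q (q * a * b / (f * g)) = x11 at *
    generalize qPochInf q (c * d * e * f * g / (q * a ^ 2 * b ^ 2)) = x12 at *
    field_simp
  simp only [R, phi, qPochsInf, List.map_cons, List.map_nil, List.prod_cons, List.prod_nil, mul_one]
  rw [← hS]
  generalize ∑' m, phiTerm q c (RNum q a b c d e f g) (RDen q a b c d e f g) m = T
  linear_combination (1 / b ^ 2 * (1 - b / a) * (b / g) * (qPochInf q q * qPochInf q c
    * qPochInf q f * qPochInf q (q * a / b) * qPochInf q (q * b / a))
    * (qPochInf q (-(q * a) / g) * qPochInf q (-(q * b) / g) * qPochInf q (q * d / f)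
      * qPochInf q (q * e / f) * qPochInf q (c * f / (a * b)) * qPochInf q (d * f / (a * b))
      * qPochInf q (e * f / (a * b)) * qPochInf q (d * e * g / (a * b))
      * qPochInf q (c * d * e * g / (a ^ 2 * b ^ 2))) * T)
    * key (qPochInf q (f / g)) (qPochInf q (q * d * e * g / (a * b * f)))

theorem rhoFactor_ne_zero (hq : ‖q‖ < 1)
    (h : ∀ x ∈ [-(q * a), -(q * b), -c / a, -c / b, -d / a, -d / b, -e / a, -e / b, -f / a, -f / b,
      -g / a, -g / b], ∀ n : ℕ, x * q ^ n ≠ 1) : rhoFactor q a b c d e f g ≠ 0 := by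
  simp only [List.forall_mem_cons] at h
  obtain ⟨h1, h2, h3, h4, h5, h6, h7, h8, h9, h10, h11, h12, -⟩ := h
  unfold rhoFactor
  simp only [mul_ne_zero_iff]
  exact ⟨⟨⟨⟨⟨⟨qPochInf_ne_zero hq h1, qPochInf_ne_zero hq h2⟩, qPochInf_ne_zero hq h3,
    qPochInf_ne_zero hq h4⟩, qPochInf_ne_zero hq h5, qPochInf_ne_zero hq h6⟩,
    qPochInf_ne_zero hq h7, qPochInf_ne_zero hq h8⟩, qPochInf_ne_zero hq h9,
    qPochInf_ne_zero hq h10⟩, qPochInf_ne_zero hq h11, qPochInf_ne_zero hq h12⟩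

end RFunction

theorem theorem2p2 (q a b c d e f g : ℂ)
    (hq0 : q ≠ 0) (hq1 : ‖q‖ < 1)
    (ha : a ≠ 0) (hb : b ≠ 0) (hc : c ≠ 0) (hd : d ≠ 0) (he : e ≠ 0) (hf : f ≠ 0) (hg : g ≠ 0)
    -- no denominator in the identity vanishes
    (hden : ∀ x ∈ [-(q * a), -(q * b), -c / a, -c / b, -d / a, -d / b, -e / a, -e / b,
        -f / a, -f / b, -g / a, -g / b, f / g, g / f, q * a * b / (f * g),
        d * e * g / (a * b * f), d * e * f / (a * b * g),
        q * d / f, q * e / f, q * d / g, q * e / g,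
        d * e * g / (a * b), d * e * f / (a * b),
        c * d * e * g / (a ^ 2 * b ^ 2), c * d * e * f / (a ^ 2 * b ^ 2)],
      ∀ n : ℕ, x * q ^ n ≠ 1)
    (hmax : max ‖c * d * e * f * g / (q * a ^ 2 * b ^ 2)‖ ‖c‖ < 1) :
    Summable (rhoTerm q a b c d e f g) ∧
    Summable (rhoTerm q b a c d e f g) ∧
    Summable (phiTerm q c (RNum q a b c d e f g) (RDen q a b c d e f g)) ∧
    Summable (phiTerm q c (RNum q a b c d e g f) (RDen q a b c d e g f)) ∧
    rho q a b c d e f g - rho q b a c d e f g = R q a b c d e f g + R q a b c d e g f := by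
  simp only [List.forall_mem_cons] at hden
  obtain ⟨n1, n2, n3, n4, n5, n6, n7, n8, n9, n10, n11, n12, hfg, hgf, hpfg, hl, hl', n18, n19, n20,
    n21, n22, n23, n24, n25, -⟩ := hden
  obtain ⟨hz, hc1⟩ := max_lt_iff.1 hmax
  have hab : a * b ≠ 0 := mul_ne_zero ha hb
  have hzeq : a * b * c * d * e * f * g / (q * (a * b) ^ 3)
      = c * d * e * f * g / (q * a ^ 2 * b ^ 2) := by
    field_simp
  have hz' : ‖a * b * c * d * e * f * g / (q * (a * b) ^ 3)‖ < 1 := by rwa [hzeq]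
  -- The two series `ρ` are the two halves of the bilateral series.
  have hF : rhoFactor q a b c d e f g ≠ 0 := rhoFactor_ne_zero hq1 (by
    simp only [List.forall_mem_cons]
    exact ⟨n1, n2, n3, n4, n5, n6, n7, n8, n9, n10, n11, n12, List.forall_mem_nil _⟩)
  have hFcomm : rhoFactor q b a c d e f g = rhoFactor q a b c d e f g := by
    unfold rhoFactor
    ring
  have t1 : ∀ k, rhoTerm q a b c d e f g k = (b * rhoFactor q a b c d e f g)⁻¹
      * psi8Term q (a * b) a (a * b) c d e f g k := fun k => by
    rw [eq_inv_mul_iff_mul_eq₀ (mul_ne_zero hb hF), ← rhoTerm_mul_rhoFactor hq0 hq1 ha hb hc hd he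
      hf hg (by
        simp only [List.forall_mem_cons]
        exact ⟨n1, n4, n6, n8, n10, n12, List.forall_mem_nil _⟩) k]
    ring
  have t2 : ∀ k, rhoTerm q b a c d e f g k = (a * rhoFactor q a b c d e f g)⁻¹
      * psi8Term q (a * b) b (a * b) c d e f g k := fun k => by
    rw [eq_inv_mul_iff_mul_eq₀ (mul_ne_zero ha hF), ← hFcomm, mul_comm a b,
      ← rhoTerm_mul_rhoFactor hq0 hq1 hb ha hc hd he
      hf hg (by
        simp only [List.forall_mem_cons]
        exact ⟨n2, n3, n5, n7, n9, n11, List.forall_mem_nil _⟩) k]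
    ring
  have s1 := summable_psi8Term hq0 hq1 ha hz'
  have s2 := summable_psi8Term hq0 hq1 hb hz'
  refine ⟨(s1.mul_left _).congr fun k => (t1 k).symm, (s2.mul_left _).congr fun k => (t2 k).symm,
    summable_phiTerm hq1 hc1 a b d e f g, summable_phiTerm hq1 hc1 a b d e g f, ?_⟩
  have hrho : (rho q a b c d e f g - rho q b a c d e f g) * rhoFactor q a b c d e f g
      = 1 / b ^ 2 * psi8Sum q (a * b) a (a * b) c d e f g := by
    unfold rho psi8Sum
    simp only [t1, t2, tsum_mul_left]
    rw [show a * b / a = b by field_simp]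
    field_simp
  have hI1 : qPochInf q (q * a * b / (f * g)) ≠ 0 := qPochInf_ne_zero hq1 hpfg
  have hI2 : qPochInf q (c * d * e * f * g / (q * a ^ 2 * b ^ 2)) ≠ 0 :=
    qPochInf_ne_zero_of_norm_lt hq1 hz
  have hR1 := R_mul_rhoFactor (e := e) (d := d) hq1 ha hb hc hf hg (by
    simp only [List.forall_mem_cons]
    exact ⟨hl, n18, n19, n22, n24, List.forall_mem_nil _⟩) hF hI1 hI2
  have hFG : rhoFactor q a b c d e g f = rhoFactor q a b c d e f g := by
    unfold rhoFactor
    ring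
  have hzG : c * d * e * g * f / (q * a ^ 2 * b ^ 2) = c * d * e * f * g / (q * a ^ 2 * b ^ 2) := by
    ring
  have hR2 := R_mul_rhoFactor (e := e) (d := d) hq1 ha hb hc hg hf (by
    simp only [List.forall_mem_cons]
    exact ⟨hl', n20, n21, n23, n25, List.forall_mem_nil _⟩) (hFG ▸ hF)
    (by rwa [mul_comm g f]) (by rwa [hzG])
  rw [hFG, mul_comm g f, hzG] at hR2
  have hB := bilateralIdentity (c₁ := a * b) (c₂ := c) hq0 hq1 hab ha hf hg hfg hgf hl hl'
    (by rwa [show a * b * c / (a * b) = c by field_simp]) hz'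
  unfold BilateralIdentity at hB
  rw [hzeq, ← mul_assoc q a b] at hB
  refine mul_right_cancel₀ (mul_ne_zero (mul_ne_zero hF hI1) hI2) ?_
  rw [add_mul, hR1, hR2]
  linear_combination qPochInf q (q * a * b / (f * g))
    * qPochInf q (c * d * e * f * g / (q * a ^ 2 * b ^ 2)) * hrho + 1 / b ^ 2 * hB
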